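/- **Setting.** Let $\bot$ be a placeholder and let $D$ be a set of digests, which also serve as file identifiers (FIDs). Let $H:(D\cup\{\bot\})^2\to D$ be a hash function, let records be hashed by a second function, and let the FID of a file be its hash under a third function. These functions are arbitrary; "barring a collision" is made precise below. *Accumulator.* A state is a vector $\vec v=(r_0,\dots,r_{m-1})$ together with perfect binary trees, the $k$-th having $2^k$ leaves, each storing an FID or $\bot$. The entry $r_k$ is the Merkle root of the $k$-th tree, where a node with two children $\bot$ has value $\bot$ and every other inner node has the $H$-value of its children. The initial vector is $(\bot)$. Leaves are numbered $1,2,\dots,2^m-1$, those of the largest tree first, from left to right; the index of a stored FID is the number of its leaf. *Upload* puts a new FID into the vacant leaf with the least number; if no leaf is vacant, all trees and the new FID (rightmost) are merged into a new tree $r_m$, and $r_0,\dots,r_{m-1}$ become $\bot$. *Deletion* sets the leaf of the FID to $\bot$. Clients upload only FIDs that are not stored and delete only FIDs that are stored. *Proofs.* An upload is recorded on a blockchain by $\langle\vec v,r_k,\vec w,\mathrm{FID},\mathrm{index},h\rangle$ and a deletion by $\langle\vec v,r_k,\vec w,\mathrm{FID},h\rangle$, where $\vec v$ is the new vector, $\vec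 w$ is the Merkle path of the FID (sibling values with left/right marks) in its tree $r_k$, and $h$ is the hash of the preceding record. A verifier knows the latest recorded vector $\vec v'$ and which leaves are occupied (public from the accepted proofs), and always checks that the FID is the requested one and that $h$ is right. - An *upload* proof is accepted iff $r_k$ is the $k$-th entry of $\vec v$ and is recomputed from $\vec w$ and the FID; the index equals $1+\sum_{i>k,\,r_i\ne\bot}2^i+\sum_{w_j\text{ left}}2^j$; and the transition is the prescribed one. The last condition means: the leaf is the first vacant one, $\vec w$ and $\bot$ recompute $r'_k$, and $\vec v,\vec v'$ agree off $k$; or, if no leaf was vacant, $\vec v=(\bot,\dots,\bot,r_m)$ and $\vec w$ consists of the old roots, all marked left. - A *deletion* proof is accepted iff $\vec w$ and the FID recompute $r'_k$; $\vec v,\vec v'$ have the same length and agree off $k$; $r_k$ is the $k$-th entry of $\vec v$; and either $r_k\ne\bot$ is recomputed from $\vec w$ and $\bot$, or $r_k=\bot$ and all siblings in $\vec w$ are $\bot$. *Retrieval.* The client reads the index of the FID and the database size $2^m-1$ from the blockchain and runs a PIR protocol. The database holds each stored file at its index and blank files elsewhere. In SPIR-DSN the PIR protocol is an arbitrary single-server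 scheme (Query, Answer, Decrypt), and the client outputs the decrypted file only if its hash is the FID. In MPIR-DSN it is Goldberg's scheme with $N=3f+1$ miners over a finite field, with distinct nonzero public evaluation points: the unit vector of the index is Shamir-shared with random polynomials of degree at most $f$; a miner answers with the product of its query vector and the database, files being blocks of $s$ field elements; from the $k$ responses received the client forms, provided $h>\sqrt{kf}$ for $h=2f+1=(2N+1)/3$, the list of all pairs (set of at least $h$ miners, block) that are explained by polynomials of degree at most $f$, and outputs the entry of this list if there is exactly one. **Theorem.** 1. *Public verifiability.* - (a) Proofs made according to the protocol are accepted. - (b) If a sequence of $T$ records, made by arbitrary miners in answer to a valid sequence of client requests, is accepted, then either every record is exactly the one that the protocol prescribes, or an explicit list of at most $4(T+1)^2$ inputs of $H$ contains a collision; these are the inputs met when the proofs are verified and the prescribed Merkle forests are computed. - (c) A prescribed upload gives the new FID the least index that is not in use, and changes no other index. A prescribed deletion removes exactly the requested FID from the mapping and changes no other index. - (d) In every state reached, different FIDs have different indices, and the index that the blockchain shows is the true one. At any time, a membership witness for the claim "FID $x$ has index $i$" against the latest vector exists if the claim is true; if one is accepted, then the claim is true or $H$ collides on the inputs met when the current forest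 is computed and the witness is checked. - (e) In SPIR-DSN, whatever the miner answers, the client outputs the correct file or nothing, or a different file with the same hash. Hence index manipulation on upload, deletion, or modification at any time is detected, barring a collision. 2. *Privacy.* Let the FID that the client retrieves be drawn uniformly from any nonempty set $X$ of stored FIDs. - *SPIR-DSN.* Suppose that no probabilistic polynomial-time adversary with polynomial advice, given a query of the single-server scheme for an index drawn uniformly from a nonempty candidate set $Y$, guesses the index with probability exceeding $1/|Y|$ by more than a negligible function of the security parameter (for polynomial database sizes and any $Y$). Then no such adversary that sees everything the miner receives guesses the queried index with probability exceeding $1/|X|$ by more than a negligible function (for request sequences of polynomial length). - *MPIR-DSN.* No adversary whatsoever that sees everything received by a coalition of at most $f=(N-1)/3$ miners guesses the queried index with probability exceeding $1/|X|$. 3. *Robustness of MPIR-DSN.* $(2N+1)/3>\sqrt{N(N-1)/3}$ for all $N\ge1$. Let $N=3f+1$, let at most $f$ miners respond arbitrarily or not at all (possibly jointly, depending on all queries), and let the others answer honestly from the replicated database. Then, for every stored FID and all random choices, the client outputs the correct file together with a set $G$ of miners whose complement consists exactly of the miners that did not return the correct answer to their query. 4. *Efficiency.* Let $n$ bound the number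 of files stored at any one time so far. - For $n\ge2$, the verification of any upload or deletion proof, correct or not, against the current recorded state takes at most $C\log n$ elementary operations (hash evaluations, comparisons or copies of digests, index arithmetic), with $C$ an absolute constant. - Let $n\ge1$. A client retrieves a stored file with exactly one PIR invocation in both protocols. In SPIR-DSN, with a correct single-server scheme and an honest miner, the client obtains the correct file. - Let $n\ge1$. Building the database and answering takes a miner $O(n)$ operations. In SPIR-DSN this is at most $C'(c+1)n$ operations if the scheme's Answer algorithm takes at most $c\cdot(\text{size}+1)$ operations on a database of the given size; in MPIR-DSN it is at most $C''(s+1)n$ field and copy operations. Here $C',C''$ are absolute constants. -/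

import Mathlib

namespace PIRDSN

/-! ## Step counting -/

/-- A value together with the number of elementary steps spent on computing it. One step is one hash
evaluation, one comparison or copy of a digest, or one operation on indices or field elements. -/
structure Timed (α : Type) where
  val : α
  cost : ℕ

instance : Monad Timed where
  pure a := ⟨a, 0⟩
  bind x f := ⟨(f x.val).val, x.cost + (f x.val).cost⟩

/-- Spend `n` steps. -/
def tick (n : ℕ) : Timed Unit := ⟨(), n⟩

/-- Continue if `b` holds, reject otherwise. -/
def check {α : Type} (b : Bool) (next : Timed (Option α)) : Timed (Option α) :=
  if b then next else pure none

/-- The length of a list. -/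
def size {α : Type} : List α → Timed ℕ
  | [] => pure 0
  | _ :: xs => do
    tick 1
    let n ← size xs
    pure (n + 1)

/-- Is the first list at most as long as the second? Both are scanned in parallel, so the cost is
bounded by the length of the second list. -/
def atMost {α β : Type} : List α → List β → Timed Bool
  | [], _ => do
    tick 1
    pure true
  | _ :: _, [] => do
    tick 1
    pure false
  | _ :: xs, _ :: ys => do
    tick 1
    atMost xs ys

/-- Equality of two lists. -/
def eqList {α : Type} [DecidableEq α] : List α → List α → Timed Bool
  | [], [] => do
    tick 1
    pure true
  | x :: xs, y :: ys => do
    tick 1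
    if x = y then eqList xs ys else pure false
  | _, _ => do
    tick 1
    pure false

/-- Apply `g` to every entry. -/
def mapList {α β : Type} (g : α → β) : List α → Timed (List β)
  | [] => pure []
  | x :: xs => do
    tick 1
    let ys ← mapList g xs
    pure (g x :: ys)

/-- Reverse a list. -/
def revList {α : Type} (xs : List α) : Timed (List α) := do
  let n ← size xs
  tick n
  pure xs.reverse

/-- The entry with exponent `k` of a list `(r_{m-1}, …, r_1, r_0)` (the last entry has exponent `0`),
together with the length of the list. -/
def entry {α : Type} (k : ℕ) : List α → Timed (Option α × ℕ)
  | [] => pure (none, 0)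
  | x :: xs => do
    let p ← entry k xs
    tick 1
    pure (if p.2 = k then some x else p.1, p.2 + 1)

/-- Do two vectors have the same length and agree in every entry except possibly the one with
exponent `k`? The second component is the number of entries scanned. -/
def agreeOff {α : Type} [DecidableEq α] (k : ℕ) : List α → List α → Timed (Bool × ℕ)
  | [], [] => pure (true, 0)
  | x :: xs, y :: ys => do
    let p ← agreeOff k xs ys
    tick 1
    pure (p.1 && (decide (p.2 = k) || decide (x = y)), p.2 + 1)
  | _, _ => do
    tick 1
    pure (false, 0)

/-! ## Merkle forests and the accumulator

`none` plays the role of the placeholder `⊥`. Digests and file identifiers (FIDs) both live in `D`. -/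

section Accumulator

variable {D : Type}

/-- The value of an inner node: `⊥` if both children are `⊥`, the hash of the children otherwise. -/
def combine (H : Option D → Option D → D) : Option D → Option D → Option D
  | none, none => none
  | a, b => some (H a b)

/-- Perfect binary trees with `2 ^ k` leaves, each storing an FID or `⊥`. -/
inductive MTree (D : Type) : ℕ → Type
  | leaf (x : Option D) : MTree D 0
  | node {k : ℕ} (l r : MTree D k) : MTree D (k + 1)

/-- A Merkle path, from the leaf level upwards: the value of the sibling, and `true` if that sibling
is the left child. -/
abbrev Witness (D : Type) := List (Option D × Bool)

namespace MTree

/-- The Merkle root; it is `⊥` exactly for the tree all of whose leaves are `⊥`. -/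
def root (H : Option D → Option D → D) : {k : ℕ} → MTree D k → Option D
  | _, leaf x => x
  | _, node l r => combine H (root H l) (root H r)

/-- The leaves from left to right. -/
def leaves : {k : ℕ} → MTree D k → List (Option D)
  | _, leaf x => [x]
  | _, node l r => leaves l ++ leaves r

/-- The tree all of whose leaves are `⊥`. -/
def empty : (k : ℕ) → MTree D k
  | 0 => leaf none
  | k + 1 => node (empty k) (empty k)

/-- Put `x` into the first vacant leaf (depth-first, left to right); `none` if the tree is full. -/
def insert (x : D) : {k : ℕ} → MTree D k → Option (MTree D k)
  | _, leaf none => some (leaf (some x))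
  | _, leaf (some _) => none
  | _, node l r =>
    match insert x l with
    | some l' => some (node l' r)
    | none => (insert x r).map (node l)

/-- Overwrite the leaf that stores `x` by `⊥`. -/
def erase [DecidableEq D] (x : D) : {k : ℕ} → MTree D k → MTree D k
  | _, leaf y => leaf (if y = some x then none else y)
  | _, node l r => node (erase x l) (erase x r)

/-- The Merkle path of `x`, if `x` is stored. -/
def witness [DecidableEq D] (H : Option D → Option D → D) (x : D) :
    {k : ℕ} → MTree D k → Option (Witness D)
  | _, leaf y => if y = some x then some [] else none
  | _, node l r =>
    match witness H x l with
    | some w => some (w ++ [(root H r, false)])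
    | none => (witness H x r).map fun w => w ++ [(root H l, true)]

/-- The inputs on which the hash function is evaluated when the root is computed (a pair `(⊥, ⊥)` is
listed but not hashed). -/
def hashInputs (H : Option D → Option D → D) : {k : ℕ} → MTree D k → List (Option D × Option D)
  | _, leaf _ => []
  | _, node l r => (root H l, root H r) :: (hashInputs H l ++ hashInputs H r)

end MTree

/-- A forest with one tree of each depth `m - 1, …, 1, 0`, listed in this order. -/
inductive Forest (D : Type) : ℕ → Type
  | nil : Forest D 0
  | cons {m : ℕ} (t : MTree D m) (rest : Forest D m) : Forest D (m + 1)

namespace Forest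

/-- The vector `(r_{m-1}, …, r_1, r_0)` of the roots. -/
def roots (H : Option D → Option D → D) : {m : ℕ} → Forest D m → List (Option D)
  | _, nil => []
  | _, cons t rest => t.root H :: roots H rest

/-- All leaves, those of the largest tree first. -/
def leaves : {m : ℕ} → Forest D m → List (Option D)
  | _, nil => []
  | _, cons t rest => t.leaves ++ leaves rest

/-- The forest all of whose leaves are `⊥`. -/
def empty : (m : ℕ) → Forest D m
  | 0 => nil
  | m + 1 => cons (MTree.empty m) (empty m)

/-- Traverse the trees from `r_{m-1}` to `r_0` and put `x` into the first vacant leaf of the first tree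
that has one; `none` if all leaves are occupied. -/
def insert (x : D) : {m : ℕ} → Forest D m → Option (Forest D m)
  | _, nil => none
  | _, cons t rest =>
    match t.insert x with
    | some t' => some (cons t' rest)
    | none => (insert x rest).map (cons t)

/-- Merge the `2 ^ m - 1` leaves of the forest and the new leaf `x` (rightmost) into a single tree. -/
def merge (x : D) : {m : ℕ} → Forest D m → MTree D m
  | _, nil => MTree.leaf (some x)
  | _, cons t rest => MTree.node t (merge x rest)

/-- Overwrite the leaf that stores `x` by `⊥`. -/
def erase [DecidableEq D] (x : D) : {m : ℕ} → Forest D m → Forest D m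
  | _, nil => nil
  | _, cons t rest => cons (t.erase x) (erase x rest)

/-- The Merkle path of `x` inside its tree `r_k`; its length is `k`. -/
def witness [DecidableEq D] (H : Option D → Option D → D) (x : D) :
    {m : ℕ} → Forest D m → Option (Witness D)
  | _, nil => none
  | _, cons t rest =>
    match t.witness H x with
    | some w => some w
    | none => witness H x rest

/-- The hash inputs of all trees. -/
def hashInputs (H : Option D → Option D → D) : {m : ℕ} → Forest D m → List (Option D × Option D)
  | _, nil => []
  | _, cons t rest => t.hashInputs H ++ hashInputs H rest

end Forest

/-- The state of the accumulator: the length `m` of its vector and the Merkle forest. -/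
structure ACA (D : Type) where
  m : ℕ
  forest : Forest D m

namespace ACA

/-- The initial accumulator, with vector `(⊥)`. -/
def gen : ACA D := ⟨1, Forest.empty 1⟩

/-- Insertion: into the first vacant leaf, or, if there is none, by merging all trees and the new
element into a new tree `r_m` and resetting `r_0, …, r_{m-1}` to `⊥`. -/
def insert (st : ACA D) (x : D) : ACA D :=
  match st.forest.insert x with
  | some F => ⟨st.m, F⟩
  | none => ⟨st.m + 1, Forest.cons (st.forest.merge x) (Forest.empty st.m)⟩

/-- Deletion: the leaf that stores `x` is set to `⊥`. -/
def delete [DecidableEq D] (st : ACA D) (x : D) : ACA D := ⟨st.m, st.forest.erase x⟩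

/-- The FID-to-index mapping that the accumulator represents: the position of the leaf of `x`, counted
from `1`, or `none` if `x` is not stored. -/
def mapping [DecidableEq D] (st : ACA D) (x : D) : Option ℕ :=
  (st.forest.leaves.idxOf? (some x)).map (· + 1)

/-- The number of files stored. -/
def stored (st : ACA D) : ℕ := (st.forest.leaves.filter Option.isSome).length

end ACA

/-! ## Proofs, records and client requests -/

/-- An upload proof `⟨v, r_k, w, FID, index, h⟩`. -/
structure UploadProof (D : Type) where
  vec : List (Option D)
  root : Option D
  wit : Witness D
  fid : D
  index : ℕ
  prev : D

/-- A deletion proof `⟨v, r_k, w, FID, h⟩`. -/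
structure DeleteProof (D : Type) where
  vec : List (Option D)
  root : Option D
  wit : Witness D
  fid : D
  prev : D

/-- A record on the blockchain. -/
inductive Record (D : Type)
  | upload (p : UploadProof D)
  | delete (p : DeleteProof D)

/-- A client request. -/
inductive Request (D : Type)
  | upload (fid : D)
  | delete (fid : D)

/-- A sequence of client requests with the records answering them, the newest entry first. -/
abbrev Log (D : Type) := List (Request D × Record D)

/-- The hash functions in use: for the inner nodes of Merkle trees, for records (the field `prev` of a
proof is the hash of the preceding record, `genesis` if there is none), and for files (the FID of a
file is its hash). -/
structure HashSuite (D File : Type) where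
  node : Option D → Option D → D
  record : Record D → D
  genesis : D
  file : File → D

/-! ## Verification -/

/-- Recompute a Merkle root from a leaf value and a witness. -/
def recompute (H : Option D → Option D → D) : Witness D → Option D → Timed (Option D)
  | [], x => pure x
  | (s, isLeft) :: w, x => do
    tick 1
    recompute H w (if isLeft then combine H s x else combine H x s)

/-- The number of leaves of the nonempty trees `r_{k+1}, …, r_{m-1}`, and the length of the vector. -/
def vecOffset (k : ℕ) : List (Option D) → Timed (ℕ × ℕ)
  | [] => pure (0, 0)
  | x :: xs => do
    let p ← vecOffset k xs
    tick 1
    pure (if k < p.2 ∧ x.isSome then p.1 + 2 ^ p.2 else p.1, p.2 + 1)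

/-- The sum of `2 ^ j` over the siblings `w_j` that are left children; the list starts at level `j`. -/
def pathOffset : ℕ → Witness D → Timed ℕ
  | _, [] => pure 0
  | j, (_, isLeft) :: w => do
    tick 1
    let o ← pathOffset (j + 1) w
    pure (if isLeft then 2 ^ j + o else o)

/-- The index assignment. -/
def assignIndex (v : List (Option D)) (w : Witness D) : Timed ℕ := do
  let k ← size w
  let a ← vecOffset k v
  let b ← pathOffset 0 w
  pure (1 + a.1 + b)

/-- Which leaves of a tree are occupied, without their values; `empty` and `full` stand for trees all of
whose leaves are vacant, respectively occupied. -/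
inductive Occ
  | empty
  | full
  | node (l r : Occ)

namespace Occ

def isFull : Occ → Bool
  | full => true
  | _ => false

def left : Occ → Occ
  | empty => empty
  | full => full
  | node l _ => l

def right : Occ → Occ
  | empty => empty
  | full => full
  | node _ r => r

/-- The tree with the given subtrees, in normal form. -/
def join : Occ → Occ → Occ
  | full, full => full
  | empty, empty => empty
  | l, r => node l r

/-- Find and occupy the first vacant leaf of a tree of depth `k`. The path is listed from the root
downwards, with `true` for a step to the right. -/
def fill : ℕ → Occ → Timed (Option (List Bool × Occ))
  | 0, o => do
    tick 1
    pure (if o.isFull then none else some ([], full))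
  | k + 1, o => do
    tick 1
    if o.isFull then pure none
    else if o.left.isFull then do
      let q ← fill k o.right
      pure (q.map fun z => (true :: z.1, join o.left z.2))
    else do
      let q ← fill k o.left
      pure (q.map fun z => (false :: z.1, join z.2 o.right))

/-- Vacate the leaf at the end of a path. -/
def clear : List Bool → Occ → Timed Occ
  | [], _ => do
    tick 1
    pure empty
  | b :: p, o => do
    tick 1
    if b then do
      let r ← clear p o.right
      pure (join o.left r)
    else do
      let l ← clear p o.left
      pure (join l o.right)

end Occ

/-- Find and occupy the first vacant leaf of a forest with trees of depths `m - 1, …, 0`; the result is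
the depth of its tree, the path inside that tree and the new occupancy. -/
def occFill : ℕ → List Occ → Timed (Option (ℕ × List Bool × List Occ))
  | m + 1, o :: os => do
    let q ← o.fill m
    match q with
    | some z => do
      tick 1
      pure (some (m, z.1, z.2 :: os))
    | none => do
      tick 1
      let q' ← occFill m os
      pure (q'.map fun z => (z.1, z.2.1, o :: z.2.2))
  | _, _ => pure none

/-- Vacate the leaf at the end of path `p` in the tree of depth `k`. -/
def occClear (k : ℕ) (p : List Bool) : List Occ → Timed (List Occ × ℕ)
  | [] => pure ([], 0)
  | o :: os => do
    let q ← occClear k p os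
    tick 1
    if q.2 = k then do
      let o' ← o.clear p
      pure (o' :: q.1, q.2 + 1)
    else pure (o :: q.1, q.2 + 1)

/-- What a verifier keeps of the recorded past: the latest vector, which leaves are occupied (this is
public, since every accepted proof shows the position that it fills or vacates), and the hash of the
latest record. -/
structure Ledger (D : Type) where
  vec : List (Option D)
  occ : List Occ
  head : D

variable {File : Type}

/-- The ledger before the first request. -/
def genesisLedger (S : HashSuite D File) : Ledger D := ⟨[none], [Occ.empty], S.genesis⟩

/-- The path described by a witness, from the root downwards. -/
def directions (w : Witness D) : Timed (List Bool) := do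
  let d ← mapList Prod.snd w
  revList d

variable [DecidableEq D]

/-- Verification of an upload proof against a request to upload `fid`. The result is the new ledger if
the proof is accepted. -/
def verifyUpload (S : HashSuite D File) (L : Ledger D) (fid : D) (p : UploadProof D) :
    Timed (Option (Ledger D)) := do
  tick 2
  check (decide (p.fid = fid) && decide (p.prev = L.head)) <| do
  let bw ← atMost p.wit L.vec
  let bv ← atMost p.vec (none :: L.vec)
  check (bw && bv) <| do
  -- existence of the FID in the new state
  let k ← size p.wit
  let e ← entry k p.vec
  let r ← recompute S.node p.wit (some fid)
  tick 2
  check (decide (e.1 = some p.root) && decide (r = p.root)) <| do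
  -- correct index
  let i ← assignIndex p.vec p.wit
  tick 1
  check (decide (i = p.index)) <| do
  -- the recorded state makes exactly this transition
  let l ← size L.vec
  let path ← directions p.wit
  let q ← occFill l L.occ
  match q with
  | some z => do
    let old ← entry k L.vec
    let r₀ ← recompute S.node p.wit none
    let same ← agreeOff k p.vec L.vec
    let samePath ← eqList path z.2.1
    tick 2
    check (decide (z.1 = k) && samePath && decide (old.1 = some r₀) && same.1) <| do
    tick (l + k + 1)
    pure (some ⟨p.vec, z.2.2, S.record (Record.upload p)⟩)
  | none => do
    let blank ← mapList (fun _ => none) L.vec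
    let okVec ← eqList p.vec (p.root :: blank)
    let sib ← mapList (fun r => (r, true)) L.vec
    let sib' ← revList sib
    let okWit ← eqList p.wit sib'
    check (okVec && okWit) <| do
    let vac ← mapList (fun _ => Occ.empty) L.vec
    tick (l + k + 1)
    pure (some ⟨p.vec, Occ.full :: vac, S.record (Record.upload p)⟩)

/-- Are all siblings of the witness `⊥`? -/
def allEmpty : Witness D → Timed Bool
  | [] => pure true
  | (s, _) :: w => do
    tick 1
    let b ← allEmpty w
    pure (s.isNone && b)

/-- Verification of a deletion proof against a request to delete `fid`. -/
def verifyDelete (S : HashSuite D File) (L : Ledger D) (fid : D) (p : DeleteProof D) :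
    Timed (Option (Ledger D)) := do
  tick 2
  check (decide (p.fid = fid) && decide (p.prev = L.head)) <| do
  let bw ← atMost p.wit L.vec
  let bv ← atMost p.vec L.vec
  check (bw && bv) <| do
  -- the FID is in the previous state and the other trees are untouched
  let k ← size p.wit
  let old ← entry k L.vec
  let r ← recompute S.node p.wit (some fid)
  let same ← agreeOff k p.vec L.vec
  tick 1
  check (decide (old.1 = some r) && same.1) <| do
  -- the deletion was executed
  let new ← entry k p.vec
  let r₀ ← recompute S.node p.wit none
  let b ← allEmpty p.wit
  tick 2
  check (decide (new.1 = some p.root) &&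
    (if p.root.isSome then decide (r₀ = p.root) else b)) <| do
  let path ← directions p.wit
  let o ← occClear k path L.occ
  let l ← size L.vec
  tick (l + k + 1)
  pure (some ⟨p.vec, o.1, S.record (Record.delete p)⟩)

/-- Verification of a record against a client request. -/
def verify (S : HashSuite D File) (L : Ledger D) : Request D → Record D → Timed (Option (Ledger D))
  | Request.upload x, Record.upload p => verifyUpload S L x p
  | Request.delete x, Record.delete p => verifyDelete S L x p
  | _, _ => do
    tick 1
    pure none

/-- Verify a whole log, from the first record on; `none` as soon as one record is rejected. -/
def replay (S : HashSuite D File) : Log D → Option (Ledger D)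
  | [] => some (genesisLedger S)
  | e :: older => (replay S older).bind fun L => (verify S L e.1 e.2).val

/-- Verification of a claim, at any time, that `fid` currently has index `idx`, given a membership
witness `w`: it must lead to the entry `r_k` of the latest vector `v`, and `idx` must be the position
of its leaf, i.e. `1` plus the number of leaves of the larger trees and to its left in its own tree. -/
def verifyClaim (S : HashSuite D File) (v : List (Option D)) (fid : D) (idx : ℕ) (w : Witness D) :
    Bool :=
  decide ((entry w.length v).val.1 = some (recompute S.node w (some fid)).val) &&
    decide (idx = 1 + ∑ j ∈ Finset.Ico (w.length + 1) v.length, 2 ^ j + (pathOffset 0 w).val)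

/-! ## Protocol-conforming execution -/

/-- The accumulator after a sequence of requests (newest first). -/
def state : List (Request D) → ACA D
  | [] => ACA.gen
  | Request.upload x :: older => (state older).insert x
  | Request.delete x :: older => (state older).delete x

/-- Clients upload only FIDs that are not stored and delete only FIDs that are stored. -/
def Valid : List (Request D) → Prop
  | [] => True
  | Request.upload x :: older => (state older).mapping x = none ∧ Valid older
  | Request.delete x :: older => (state older).mapping x ≠ none ∧ Valid older

/-- The largest number of files stored at the same time during a sequence of requests. -/
def peak : List (Request D) → ℕ
  | [] => 0
  | r :: older => max (state (r :: older)).stored (peak older)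

/-- The hash of the latest record. -/
def headHash (S : HashSuite D File) : Log D → D
  | [] => S.genesis
  | e :: _ => S.record e.2

/-- The upload proof of a miner that follows the protocol. -/
def makeUpload (S : HashSuite D File) (st : ACA D) (x prev : D) : UploadProof D :=
  let v := (st.insert x).forest.roots S.node
  let w := ((st.insert x).forest.witness S.node x).getD []
  { vec := v
    root := (entry w.length v).val.1.getD none
    wit := w
    fid := x
    index := (assignIndex v w).val
    prev := prev }

/-- The deletion proof of a miner that follows the protocol. -/
def makeDelete (S : HashSuite D File) (st : ACA D) (x prev : D) : DeleteProof D :=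
  let v := (st.delete x).forest.roots S.node
  let w := (st.forest.witness S.node x).getD []
  { vec := v
    root := (entry w.length v).val.1.getD none
    wit := w
    fid := x
    prev := prev }

/-- The log that results if all requests are answered according to the protocol. -/
def honestLog (S : HashSuite D File) : List (Request D) → Log D
  | [] => []
  | Request.upload x :: older =>
    (Request.upload x,
      Record.upload (makeUpload S (state older) x (headHash S (honestLog S older)))) ::
        honestLog S older
  | Request.delete x :: older =>
    (Request.delete x,
      Record.delete (makeDelete S (state older) x (headHash S (honestLog S older)))) ::
        honestLog S older

/-! ## Explicit hash collisions -/

/-- The hash inputs met when a root is recomputed from a witness. -/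
def pathInputs (H : Option D → Option D → D) : Witness D → Option D → List (Option D × Option D)
  | [], _ => []
  | (s, isLeft) :: w, x =>
    (if isLeft then (s, x) else (x, s)) ::
      pathInputs H w (if isLeft then combine H s x else combine H x s)

/-- The hash inputs met when a record is verified. -/
def recordInputs (H : Option D → Option D → D) : Record D → List (Option D × Option D)
  | Record.upload p => pathInputs H p.wit (some p.fid) ++ pathInputs H p.wit none
  | Record.delete p => pathInputs H p.wit (some p.fid) ++ pathInputs H p.wit none

/-- The hash inputs met when a log is verified and the Merkle forests that its requests prescribe are
computed. -/
def logInputs (H : Option D → Option D → D) : Log D → List (Option D × Option D)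
  | [] => []
  | e :: older =>
    (state (older.map Prod.fst)).forest.hashInputs H ++ recordInputs H e.2 ++ logInputs H older

/-- Two different inputs in the list `xs`, both of them really hashed, have the same hash. -/
def CollisionIn (H : Option D → Option D → D) (xs : List (Option D × Option D)) : Prop :=
  ∃ a ∈ xs, ∃ b ∈ xs, a ≠ b ∧ a ≠ (none, none) ∧ b ≠ (none, none) ∧ H a.1 a.2 = H b.1 b.2

/-! ## Retrieval: what clients and miners do -/

/-- The index of an FID according to the proofs on the blockchain: that of its upload proof, unless it
was deleted afterwards. -/
def lookupIndex : Log D → D → Option ℕ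
  | [], _ => none
  | (_, Record.upload p) :: older, x => if p.fid = x then some p.index else lookupIndex older x
  | (_, Record.delete p) :: older, x => if p.fid = x then none else lookupIndex older x

/-- The size of the database according to the latest proof: `2 ^ m - 1` leaves for a vector of length
`m`. -/
def dbSize : Log D → ℕ
  | [] => 1
  | (_, Record.upload p) :: _ => 2 ^ p.vec.length - 1
  | (_, Record.delete p) :: _ => 2 ^ p.vec.length - 1

/-- The database of a miner: the file with index `i` is the `i`-th entry, the other entries are blank. -/
def database (blank : File) (files : D → File) (st : ACA D) : Timed (List File) :=
  mapList (fun o => o.elim blank files) st.forest.leaves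

/-- Client programs that may invoke a PIR protocol: an invocation names the database size and the index
and continues with the result `ρ` that the PIR protocol delivers to the client. -/
inductive PIRProg (ρ α : Type)
  | done (a : α)
  | invoke (size idx : ℕ) (next : ρ → PIRProg ρ α)

/-- The client of the single-miner protocol. A decrypted file is output only if its hash is the FID. -/
def retrieveSingle (S : HashSuite D File) (log : Log D) (fid : D) :
    PIRProg (Option File) (Option File) :=
  match lookupIndex log fid with
  | none => PIRProg.done none
  | some i => PIRProg.invoke (dbSize log) i fun r =>
      PIRProg.done (r.filter fun g => decide (S.file g = fid))

/-- The client of the multi-miner protocol. -/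
def retrieveMulti {ρ : Type} (log : Log D) (fid : D) : PIRProg (Option ρ) (Option ρ) :=
  match lookupIndex log fid with
  | none => PIRProg.done none
  | some i => PIRProg.invoke (dbSize log) i fun r => PIRProg.done r

end Accumulator

/-! ## Polynomial-time adversaries -/

/-- Computable by a Turing machine in polynomial time. -/
def PolyTime (g : List Bool → List Bool) : Prop :=
  ∃ M : Turing.TM2ComputableInPolyTime (id : List Bool → List Bool) (id : List Bool → List Bool) g,
    ∀ k, Finite (M.tm.Γ k)

def PolyBounded (g : ℕ → ℕ) : Prop := ∃ p : Polynomial ℕ, ∀ l, g l ≤ p.eval l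

def Negligible (ε : ℕ → ℝ) : Prop :=
  Asymptotics.SuperpolynomialDecay Filter.atTop (fun l : ℕ => (l : ℝ)) ε

/-- Self-delimiting encoding of a bit string. -/
def frame (b : List Bool) : List Bool := b.flatMap (fun x => [true, x]) ++ [false]

/-- A probabilistic polynomial-time adversary with advice of polynomial length. -/
structure Adversary where
  run : List Bool → List Bool
  run_poly : PolyTime run
  coins : Polynomial ℕ
  advice : ℕ → List Bool
  advice_poly : PolyBounded fun l => (advice l).length

/-- The adversary's guess, given the security parameter `l`, the database size and all messages that it
received. -/
noncomputable def Adversary.guess (A : Adversary) (l size : ℕ) (msgs : List (List Bool)) : PMF ℕ :=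
  (PMF.uniformOfFintype (Fin (A.coins.eval l) → Bool)).map fun c =>
    Computability.decodeNat (A.run
      (frame (List.replicate l true) ++ frame (Computability.encodeNat size) ++
        frame (A.advice l) ++ frame (List.ofFn c) ++ msgs.flatMap frame))

/-! ## Single-server PIR -/

/-- A single-server PIR scheme `(Query, Answer, Decrypt)` for records of type `File`. The first argument
is the security parameter. `query l size i` asks for the `i`-th entry, counted from `1`, of a database
with `size` entries; its secret output is kept by the client for `decrypt`. -/
structure SinglePIR (File : Type) where
  Secret : Type
  Ans : Type
  query : ℕ → ℕ → ℕ → PMF (List Bool × Secret)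
  answer : ℕ → List Bool → List File → Timed Ans
  decrypt : ℕ → Secret → Ans → Option File

namespace SinglePIR

variable {File : Type}

/-- An honest client interacting with an honest server always retrieves the correct record. -/
def Correct (P : SinglePIR File) : Prop :=
  ∀ (l : ℕ) (db : List File) (i : ℕ) (hi : i < db.length),
    ∀ x ∈ (P.query l db.length (i + 1)).support,
      P.decrypt l x.2 (P.answer l x.1 db).val = some db[i]

/-- The game of guessing an index that is drawn uniformly from `X`, given the query: did the adversary
guess correctly? -/
noncomputable def game (P : SinglePIR File) (A : Adversary) (l size : ℕ) (X : Finset ℕ)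
    (hX : X.Nonempty) : PMF Bool :=
  (PMF.uniformOfFinset X hX).bind fun i =>
    (P.query l size i).bind fun x =>
      (A.guess l size [x.1]).map fun g => decide (g = i)

/-- No polynomial-time adversary guesses the queried index better than at random (up to a negligible
advantage), whatever set of candidates the index is drawn from. -/
def Private (P : SinglePIR File) : Prop :=
  ∀ (A : Adversary) (size : ℕ → ℕ), PolyBounded size →
    ∀ (X : ℕ → Finset ℕ) (hX : ∀ l, (X l).Nonempty), (∀ l, X l ⊆ Finset.Icc 1 (size l)) →
      ∃ ε : ℕ → ℝ, Negligible ε ∧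
        ∀ l, (P.game A l (size l) (X l) (hX l) true).toReal ≤ 1 / ((X l).card : ℝ) + ε l

/-- The server's work per database entry is at most `c l` steps. -/
def LinearAnswer (P : SinglePIR File) (c : ℕ → ℕ) : Prop :=
  ∀ (l : ℕ) (q : List Bool) (db : List File), (P.answer l q db).cost ≤ c l * (db.length + 1)

/-- Run a client program, with the miner's answers given by an arbitrary function of the query. The
outcome is the client's output and the list of all queries that the miner received. -/
noncomputable def exec {α : Type} (P : SinglePIR File) (l : ℕ) (miner : List Bool → P.Ans) :
    PIRProg (Option File) α → PMF (α × List (List Bool))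
  | PIRProg.done a => PMF.pure (a, [])
  | PIRProg.invoke size idx next =>
    (P.query l size idx).bind fun x =>
      (exec P l miner (next (P.decrypt l x.2 (miner x.1)))).map fun y => (y.1, x.1 :: y.2)

variable {D : Type} [DecidableEq D]

/-- The answer of an honest miner. -/
def minerAnswer (P : SinglePIR File) (l : ℕ) (blank : File) (files : D → File) (st : ACA D)
    (q : List Bool) : Timed P.Ans := do
  let db ← database blank files st
  P.answer l q db

/-- The game of guessing the index queried in a run of the single-miner protocol in which the client
retrieves a file drawn uniformly from `X`, given everything that the miner received. -/
noncomputable def retrievalGame (P : SinglePIR File) (S : HashSuite D File) (A : Adversary) (l : ℕ)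
    (miner : List Bool → P.Ans) (log : Log D) (X : Finset D) (hX : X.Nonempty) : PMF Bool :=
  (PMF.uniformOfFinset X hX).bind fun fid =>
    (P.exec l miner (retrieveSingle S log fid)).bind fun y =>
      (A.guess l (dbSize log) y.2).map fun g => decide (lookupIndex log fid = some g)

end SinglePIR

/-! ## Goldberg's Byzantine-robust multi-server PIR

Databases are lists of blocks of `s` words over a finite field. `pts i` is the public nonzero
evaluation point of server `i`. -/

section Goldberg

variable {F : Type} [Field F] [Fintype F] [DecidableEq F] {N s : ℕ}

/-- The queries: the unit vector of the index, each coordinate Shamir-shared with a uniformly random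
polynomial of degree at most `t`. -/
noncomputable def multiQuery (t : ℕ) (pts : Fin N → F) (size idx : ℕ) : PMF (Fin N → List F) :=
  (PMF.uniformOfFintype (Fin size → Fin t → F)).map fun c i =>
    List.ofFn fun j : Fin size =>
      (if (j : ℕ) + 1 = idx then 1 else 0) + ∑ e : Fin t, c j e * pts i ^ ((e : ℕ) + 1)

/-- The answer to a query: the product of the query vector and the database. -/
def multiAnswer : List F → List (Fin s → F) → Timed (Fin s → F)
  | a :: q, b :: db => do
    tick (s + 1)
    let r ← multiAnswer q db
    pure fun w => a * b w + r w
  | _, _ => pure fun _ => 0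

/-- The servers whose complete response lies on the given polynomials (one for each word of the block,
with coefficients `c w 0, …, c w t`). -/
def agreeSet {t : ℕ} (pts : Fin N → F) (resp : Fin N → Option (Fin s → F))
    (c : Fin s → Fin (t + 1) → F) : Finset (Fin N) :=
  Finset.univ.filter fun i => resp i = some fun w => ∑ e, c w e * pts i ^ (e : ℕ)

/-- The list that the decoder outputs, for `k` received responses of which at least `h` are assumed to be
honest: provided that `h > √(k t)`, all pairs of a set of at least `h` servers and a block that are
explained by polynomials of degree at most `t`. -/
def decodeList (t h : ℕ) (pts : Fin N → F) (resp : Fin N → Option (Fin s → F)) :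
    Finset (Finset (Fin N) × (Fin s → F)) :=
  if (Finset.univ.filter fun i => (resp i).isSome = true).card * t < h ^ 2 then
    (Finset.univ.filter fun c : Fin s → Fin (t + 1) → F => h ≤ (agreeSet pts resp c).card).image
      fun c => (agreeSet pts resp c, fun w => c w 0)
  else ∅

open Classical in
/-- Reconstruction succeeds if the list has exactly one entry. -/
noncomputable def reconstruct (t h : ℕ) (pts : Fin N → F) (resp : Fin N → Option (Fin s → F)) :
    Option (Finset (Fin N) × (Fin s → F)) :=
  if hx : ∃ x, decodeList t h pts resp = {x} then some hx.choose else none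

/-- Run a client program. The miners' responses (`none` for a miner that does not respond in time) are
given by an arbitrary function of all queries. The outcome is the client's output and the list of all
query vectors sent. -/
noncomputable def multiExec {α : Type} (t h : ℕ) (pts : Fin N → F)
    (miners : (Fin N → List F) → Fin N → Option (Fin s → F)) :
    PIRProg (Option (Finset (Fin N) × (Fin s → F))) α → PMF (α × List (Fin N → List F))
  | PIRProg.done a => PMF.pure (a, [])
  | PIRProg.invoke size idx next =>
    (multiQuery t pts size idx).bind fun q =>
      (multiExec t h pts miners (next (reconstruct t h pts (miners q)))).map fun y =>
        (y.1, q :: y.2)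

variable {D : Type} [DecidableEq D]

/-- The answer of an honest miner. -/
def multiMinerAnswer (files : D → Fin s → F) (st : ACA D) (q : List F) : Timed (Fin s → F) := do
  let db ← database (fun _ => 0) files st
  multiAnswer q db

/-- The game of guessing the index queried in a run of the multi-miner protocol in which the client
retrieves a file drawn uniformly from `X`, given everything that the coalition `T` received; the
guessing strategy is unrestricted. -/
noncomputable def multiRetrievalGame (t h : ℕ) (pts : Fin N → F)
    (miners : (Fin N → List F) → Fin N → Option (Fin s → F)) (T : Finset (Fin N))
    (guess : List (T → List F) → PMF ℕ) (log : Log D) (X : Finset D) (hX : X.Nonempty) : PMF Bool :=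
  (PMF.uniformOfFinset X hX).bind fun fid =>
    (multiExec t h pts miners
      (retrieveMulti (ρ := Finset (Fin N) × (Fin s → F)) log fid)).bind fun y =>
        (guess (y.2.map fun q (i : T) => q i)).map fun g => decide (lookupIndex log fid = some g)

end Goldberg

/-! ## The four properties -/

/-- Public verifiability. -/
def PublicVerifiability : Prop :=
  ∀ (D File : Type) [DecidableEq D] (S : HashSuite D File),
    -- proofs made according to the protocol are accepted
    (∀ reqs : List (Request D), Valid reqs → (replay S (honestLog S reqs)).isSome) ∧
    -- no other proof is accepted, unless verification exhibits a hash collision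
    (∀ log : Log D, Valid (log.map Prod.fst) → (replay S log).isSome →
      (log = honestLog S (log.map Prod.fst) ∨ CollisionIn S.node (logInputs S.node log)) ∧
      (logInputs S.node log).length ≤ 4 * (log.length + 1) ^ 2) ∧
    -- an upload gives the new FID the least index that is not in use, and changes nothing else
    (∀ (reqs : List (Request D)) (x : D), Valid (Request.upload x :: reqs) →
      ∃ i, IsLeast {j : ℕ | 1 ≤ j ∧ ∀ y, (state reqs).mapping y ≠ some j} i ∧
        (state (Request.upload x :: reqs)).mapping =
          Function.update (state reqs).mapping x (some i)) ∧
    -- a deletion removes the requested FID, and changes nothing else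
    (∀ (reqs : List (Request D)) (x : D), Valid (Request.delete x :: reqs) →
      (state (Request.delete x :: reqs)).mapping =
        Function.update (state reqs).mapping x none) ∧
    -- different FIDs have different indices, and at any time the blockchain shows the true index
    (∀ reqs : List (Request D), Valid reqs →
      (∀ x y i, (state reqs).mapping x = some i → (state reqs).mapping y = some i → x = y) ∧
      ∀ x, lookupIndex (honestLog S reqs) x = (state reqs).mapping x) ∧
    -- at any time, exactly the true index of an FID can be proved, barring a hash collision
    (∀ (reqs : List (Request D)) (L : Ledger D), Valid reqs →
      replay S (honestLog S reqs) = some L → ∀ (x : D) (i : ℕ),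
        ((state reqs).mapping x = some i → ∃ w, verifyClaim S L.vec x i w = true) ∧
        ∀ w, verifyClaim S L.vec x i w = true → (state reqs).mapping x = some i ∨
          CollisionIn S.node
            ((state reqs).forest.hashInputs S.node ++ pathInputs S.node w (some x))) ∧
    -- a client that retrieves from a miner with a manipulated database gets the correct file or
    -- nothing, barring a collision of the file hash
    (∀ (P : SinglePIR File) (l : ℕ) (log : Log D) (x : D) (g : File) (miner : List Bool → P.Ans),
      S.file g = x → ∀ y ∈ (P.exec l miner (retrieveSingle S log x)).support,
        y.1 = none ∨ y.1 = some g ∨ ∃ g', y.1 = some g' ∧ g' ≠ g ∧ S.file g' = S.file g)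

/-- Privacy of the single-miner protocol. -/
def SinglePrivacy : Prop :=
  ∀ (D File : Type) [DecidableEq D] (P : SinglePIR File), P.Private →
    ∀ (S : ℕ → HashSuite D File) (reqs : ℕ → List (Request D)) (A : Adversary)
      (miner : ℕ → List Bool → P.Ans) (X : ℕ → Finset D) (hX : ∀ l, (X l).Nonempty),
      (∀ l, Valid (reqs l)) → PolyBounded (fun l => (reqs l).length) →
      (∀ l, ∀ x ∈ X l, (state (reqs l)).mapping x ≠ none) →
      ∃ ε : ℕ → ℝ, Negligible ε ∧ ∀ l,
        (P.retrievalGame (S l) A l (miner l) (honestLog (S l) (reqs l)) (X l) (hX l) true).toReal ≤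
          1 / ((X l).card : ℝ) + ε l

/-- Privacy of the multi-miner protocol with `3 f + 1` miners against coalitions of `f` miners. -/
def MultiPrivacy : Prop :=
  ∀ (D F : Type) [DecidableEq D] [Field F] [Fintype F] [DecidableEq F] (f s : ℕ)
    (S : HashSuite D (Fin s → F)) (pts : Fin (3 * f + 1) → F),
    Function.Injective pts → (∀ i, pts i ≠ 0) →
    ∀ (reqs : List (Request D)), Valid reqs →
    ∀ (miners : (Fin (3 * f + 1) → List F) → Fin (3 * f + 1) → Option (Fin s → F))
      (T : Finset (Fin (3 * f + 1))), T.card ≤ f →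
    ∀ (guess : List (T → List F) → PMF ℕ) (X : Finset D) (hX : X.Nonempty),
      (∀ x ∈ X, (state reqs).mapping x ≠ none) →
      (multiRetrievalGame f (2 * f + 1) pts miners T guess (honestLog S reqs) X hX true).toReal ≤
        1 / (X.card : ℝ)

/-- Robustness of the multi-miner protocol with `3 f + 1` miners, at most `f` of them faulty. -/
def Robustness : Prop :=
  (∀ N : ℕ, 1 ≤ N → Real.sqrt ((N : ℝ) * ((N : ℝ) - 1) / 3) < (2 * (N : ℝ) + 1) / 3) ∧
  ∀ (D F : Type) [DecidableEq D] [Field F] [Fintype F] [DecidableEq F] (f s : ℕ)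
    (S : HashSuite D (Fin s → F)) (pts : Fin (3 * f + 1) → F),
    Function.Injective pts → (∀ i, pts i ≠ 0) →
    ∀ (reqs : List (Request D)), Valid reqs →
    ∀ (files : D → Fin s → F)
      (miners : (Fin (3 * f + 1) → List F) → Fin (3 * f + 1) → Option (Fin s → F))
      (B : Finset (Fin (3 * f + 1))), B.card ≤ f →
      (∀ q, ∀ i ∉ B, miners q i = some (multiMinerAnswer files (state reqs) (q i)).val) →
    ∀ x, (state reqs).mapping x ≠ none →
    ∀ y ∈ (multiExec f (2 * f + 1) pts miners (retrieveMulti (honestLog S reqs) x)).support,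
      ∃ (q : Fin (3 * f + 1) → List F) (G : Finset (Fin (3 * f + 1))),
        y.2 = [q] ∧ y.1 = some (G, files x) ∧
        ∀ i, i ∉ G ↔ miners q i ≠ some (multiMinerAnswer files (state reqs) (q i)).val

/-- Efficiency. -/
def Efficiency : Prop :=
  -- verification of any proof, correct or not
  (∃ C : ℝ, ∀ (D File : Type) [DecidableEq D] (S : HashSuite D File) (reqs : List (Request D))
    (L : Ledger D) (n : ℕ), Valid reqs → peak reqs ≤ n → 2 ≤ n →
    replay S (honestLog S reqs) = some L →
    ∀ (r : Request D) (p : Record D), ((verify S L r p).cost : ℝ) ≤ C * Real.log n) ∧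
  -- retrieval from a single miner
  (∃ C : ℕ, ∀ (D File : Type) [DecidableEq D] (S : HashSuite D File) (P : SinglePIR File)
    (reqs : List (Request D)) (blank : File) (files : D → File) (n l : ℕ),
    P.Correct → Valid reqs →
    (∀ x, (state reqs).mapping x ≠ none → S.file (files x) = x) → peak reqs ≤ n → 1 ≤ n →
    (∀ x, (state reqs).mapping x ≠ none →
      (∀ miner, ∀ y ∈ (P.exec l miner (retrieveSingle S (honestLog S reqs) x)).support,
        y.2.length = 1) ∧
      ∀ y ∈ (P.exec l (fun q => (P.minerAnswer l blank files (state reqs) q).val)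
        (retrieveSingle S (honestLog S reqs) x)).support, y.1 = some (files x)) ∧
    ∀ c, P.LinearAnswer c → ∀ q,
      (P.minerAnswer l blank files (state reqs) q).cost ≤ C * (c l + 1) * n) ∧
  -- retrieval from several miners
  (∃ C : ℕ, ∀ (D F : Type) [DecidableEq D] [Field F] [Fintype F] [DecidableEq F] (f s : ℕ)
    (S : HashSuite D (Fin s → F)) (pts : Fin (3 * f + 1) → F) (reqs : List (Request D))
    (files : D → Fin s → F) (n : ℕ), Valid reqs → peak reqs ≤ n → 1 ≤ n →
    (∀ miners, ∀ x, (state reqs).mapping x ≠ none →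
      ∀ y ∈ (multiExec f (2 * f + 1) pts miners
        (retrieveMulti (ρ := Finset (Fin (3 * f + 1)) × (Fin s → F)) (honestLog S reqs) x)).support,
        y.2.length = 1) ∧
    ∀ q, (multiMinerAnswer files (state reqs) q).cost ≤ C * (s + 1) * n)

end PIRDSN

/-! The whole accumulator is described by addresses: a leaf is given by the depth `k` of its tree
and a path of bits from the root, and `find`, `get`, `set` and `path` act on addresses. Insertion
fills the first vacant address or merges a full forest; deletion clears the only address that holds
the FID, since no FID is stored twice (`uniq_state`). The Merkle path of an address does not depend
on the content of its leaf, so one witness recomputes the root before and after a change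
(`recompute_path`). The index of an address is `treeOffset + pathPos + 1`.

Public verifiability. Honest proofs pass because the verifier's ledger always mirrors the true
forest (`replay_honestLog`). Conversely, compare a witness with the true tree from the root
downwards: at each level two pairs from the listed inputs have the same hash, so without a collision
they are equal, and the witness is the true path to a leaf with the claimed content
(`path_of_recompute`). For an upload into a vacant leaf this is applied with content `⊥`, the
position being fixed by the public occupancy; for a deletion, with the FID as content. In a merge
the witness is prescribed outright. All other fields are then determined, and induction over the log
finishes. The number of listed inputs is bounded because the vector grows only when all `2 ^ m - 1`
leaves are occupied, whence `2 ^ m ≤ 2 * max 1 peak` (`two_pow_le_peak`).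

Privacy. Distinct stored FIDs have distinct indices, so a uniform FID yields a uniform index. With
one miner the retrieval game is then literally the game of the PIR scheme (`retrievalGame_eq`). With
several miners, translating the random coefficients turns the shares of one unit vector, as seen by
at most `f` miners, into those of any other (`multiQuery_view_eq`), so the guess is independent of
the index.

Robustness. Correct answers are values of polynomials of degree at most `f` whose constant terms
form the file (`exists_answer_coeff`). Two explanations by `2 f + 1` of the `3 f + 1` miners share
`f + 1` evaluation points and therefore coincide, so the list has one entry (`reconstruct_eq`).

Efficiency. Oversized proofs are rejected after scans bounded by the verifier's own vector; what
follows is a fixed number of passes of length `O(m)`. Again `two_pow_le_peak` makes `m` logarithmic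
and the database linear in `n`. -/

namespace PIRDSN

/-! ## Values and costs of the timed primitives -/

namespace Timed

variable {α β : Type}

@[simp] theorem val_bind (x : Timed α) (f : α → Timed β) : (x >>= f).val = (f x.val).val := rfl

@[simp] theorem cost_bind (x : Timed α) (f : α → Timed β) :
    (x >>= f).cost = x.cost + (f x.val).cost := rfl

@[simp] theorem val_pure (a : α) : (pure a : Timed α).val = a := rfl

@[simp] theorem cost_pure (a : α) : (pure a : Timed α).cost = 0 := rfl

@[simp] theorem cost_tick (n : ℕ) : (tick n).cost = n := rfl

end Timed

open Timed

theorem check_val_eq_some {α : Type} (b : Bool) (next : Timed (Option α)) (a : α) :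
    (check b next).val = some a ↔ b = true ∧ next.val = some a := by
  cases b <;> simp [check]

section Lists

variable {α β : Type}

@[simp] theorem size_val (xs : List α) : (size xs).val = xs.length := by
  induction xs with
  | nil => rfl
  | cons x xs ih => simp [size, ih]

@[simp] theorem size_cost (xs : List α) : (size xs).cost = xs.length := by
  induction xs with
  | nil => rfl
  | cons x xs ih => simp [size, ih, add_comm]

@[simp] theorem atMost_val (xs : List α) (ys : List β) :
    (atMost xs ys).val = decide (xs.length ≤ ys.length) := by
  induction xs generalizing ys with
  | nil => simp [atMost]
  | cons x xs ih => cases ys <;> simp [atMost, ih]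

theorem atMost_cost_le (xs : List α) (ys : List β) : (atMost xs ys).cost ≤ ys.length + 1 := by
  induction xs generalizing ys with
  | nil => simp [atMost]
  | cons x xs ih =>
    cases ys with
    | nil => simp [atMost]
    | cons y ys => have := ih ys; simp [atMost]; omega

@[simp] theorem eqList_val [DecidableEq α] (xs ys : List α) :
    (eqList xs ys).val = decide (xs = ys) := by
  induction xs generalizing ys with
  | nil => cases ys <;> simp [eqList]
  | cons x xs ih =>
    cases ys with
    | nil => simp [eqList]
    | cons y ys => by_cases h : x = y <;> simp [eqList, h, ih]

theorem eqList_cost_le [DecidableEq α] (xs ys : List α) : (eqList xs ys).cost ≤ xs.length + 1 := by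
  induction xs generalizing ys with
  | nil => cases ys <;> simp [eqList]
  | cons x xs ih =>
    cases ys with
    | nil => simp [eqList]
    | cons y ys =>
      have := ih ys
      by_cases h : x = y
      · simp [eqList, h]; omega
      · simp [eqList, h]

@[simp] theorem mapList_val (g : α → β) (xs : List α) : (mapList g xs).val = xs.map g := by
  induction xs with
  | nil => rfl
  | cons x xs ih => simp [mapList, ih]

@[simp] theorem mapList_cost (g : α → β) (xs : List α) : (mapList g xs).cost = xs.length := by
  induction xs with
  | nil => rfl
  | cons x xs ih => simp [mapList, ih, add_comm]

@[simp] theorem revList_val (xs : List α) : (revList xs).val = xs.reverse := rfl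

@[simp] theorem revList_cost (xs : List α) : (revList xs).cost = 2 * xs.length := by
  simp [revList, two_mul]

@[simp] theorem entry_val_snd (k : ℕ) (xs : List α) : (entry k xs).val.2 = xs.length := by
  induction xs with
  | nil => rfl
  | cons x xs ih => simp [entry, ih]

@[simp] theorem entry_nil (k : ℕ) : (entry k ([] : List α)).val.1 = none := rfl

theorem entry_cons (k : ℕ) (x : α) (xs : List α) :
    (entry k (x :: xs)).val.1 = if xs.length = k then some x else (entry k xs).val.1 := by
  simp [entry]

@[simp] theorem entry_cost (k : ℕ) (xs : List α) : (entry k xs).cost = xs.length := by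
  induction xs with
  | nil => rfl
  | cons x xs ih => simp [entry, ih]

theorem entry_eq_none {k : ℕ} {xs : List α} (h : xs.length ≤ k) : (entry k xs).val.1 = none := by
  induction xs with
  | nil => rfl
  | cons x xs ih =>
    simp only [List.length_cons] at h
    rw [entry_cons, if_neg (by omega), ih (by omega)]

theorem lt_of_entry_eq_some {k : ℕ} {xs : List α} {a : α} (h : (entry k xs).val.1 = some a) :
    k < xs.length := by
  by_contra hk
  rw [entry_eq_none (by omega)] at h
  simp at h

/-- Replace the entry with exponent `k` of a vector. -/
def replaceEntry (k : ℕ) (r : α) : List α → List α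
  | [] => []
  | x :: xs => if xs.length = k then r :: xs else x :: replaceEntry k r xs

@[simp] theorem length_replaceEntry (k : ℕ) (r : α) (xs : List α) :
    (replaceEntry k r xs).length = xs.length := by
  induction xs with
  | nil => rfl
  | cons x xs ih => by_cases h : xs.length = k <;> simp [replaceEntry, h, ih]

theorem entry_replaceEntry {k : ℕ} {xs : List α} (r : α) (h : k < xs.length) :
    (entry k (replaceEntry k r xs)).val.1 = some r := by
  induction xs with
  | nil => simp at h
  | cons x xs ih =>
    simp only [List.length_cons] at h
    by_cases hk : xs.length = k
    · simp [replaceEntry, hk, entry_cons]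
    · simp only [replaceEntry, hk, if_false, entry_cons, length_replaceEntry]
      exact ih (by omega)

variable [DecidableEq α]

theorem agreeOff_val_snd {k : ℕ} {xs ys : List α} (h : xs.length = ys.length) :
    (agreeOff k xs ys).val.2 = xs.length := by
  induction xs generalizing ys with
  | nil => cases ys <;> simp_all [agreeOff]
  | cons x xs ih => cases ys <;> simp_all [agreeOff]

theorem agreeOff_length {k : ℕ} {xs ys : List α} (h : (agreeOff k xs ys).val.1 = true) :
    xs.length = ys.length := by
  induction xs generalizing ys with
  | nil => cases ys <;> simp_all [agreeOff]
  | cons x xs ih =>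
    cases ys with
    | nil => simp [agreeOff] at h
    | cons y ys => simp [agreeOff] at h; simp [ih h.1]

/-- The counter returned by `agreeOff` is the true length only if the tails have equal lengths.
Otherwise the conjunction is false anyway, so the length may replace the counter. -/
theorem agreeOff_cons (k : ℕ) (x y : α) (xs ys : List α) :
    (agreeOff k (x :: xs) (y :: ys)).val.1 = true ↔
      (agreeOff k xs ys).val.1 = true ∧ (xs.length = k ∨ x = y) := by
  simp only [agreeOff, val_bind, val_pure, Bool.and_eq_true, Bool.or_eq_true, decide_eq_true_eq]
  refine and_congr_right fun h => ?_
  rw [agreeOff_val_snd (agreeOff_length h)]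

theorem agreeOff_self (k : ℕ) (xs : List α) : (agreeOff k xs xs).val.1 = true := by
  induction xs with
  | nil => rfl
  | cons x xs ih => simp [agreeOff_cons, ih]

theorem eq_of_agreeOff {k : ℕ} {xs ys : List α} (h : (agreeOff k xs ys).val.1 = true)
    (hk : xs.length ≤ k) : xs = ys := by
  induction xs generalizing ys with
  | nil => have := agreeOff_length h; cases ys <;> simp_all
  | cons x xs ih =>
    cases ys with
    | nil => simp [agreeOff] at h
    | cons y ys =>
      rw [agreeOff_cons] at h
      simp only [List.length_cons] at hk
      rw [ih h.1 (by omega), h.2.resolve_left (by omega)]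

/-- The two vector checks of a verifier leave no freedom: all entries but one are copied from the
old vector, and the remaining one is shown in the proof. -/
theorem eq_replaceEntry_of_agreeOff {k : ℕ} {xs ys : List α} {r : α}
    (h : (agreeOff k xs ys).val.1 = true) (hr : (entry k xs).val.1 = some r) :
    xs = replaceEntry k r ys := by
  induction xs generalizing ys with
  | nil => simp at hr
  | cons x xs ih =>
    cases ys with
    | nil => simp [agreeOff] at h
    | cons y ys =>
      rw [agreeOff_cons] at h
      have hl := agreeOff_length h.1
      rw [entry_cons] at hr
      by_cases hk : xs.length = k
      · rw [if_pos hk] at hr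
        rw [replaceEntry, if_pos (hl ▸ hk), eq_of_agreeOff h.1 hk.le, Option.some.inj hr]
      · rw [if_neg hk] at hr
        rw [replaceEntry, if_neg (hl ▸ hk), ← ih h.1 hr, h.2.resolve_left hk]

theorem agreeOff_replaceEntry (k : ℕ) (r : α) (ys : List α) :
    (agreeOff k (replaceEntry k r ys) ys).val.1 = true := by
  induction ys with
  | nil => rfl
  | cons y ys ih =>
    by_cases hk : ys.length = k
    · simp [replaceEntry, hk, agreeOff_cons, agreeOff_self]
    · simp [replaceEntry, hk, agreeOff_cons, ih]

theorem agreeOff_cost_le (k : ℕ) (xs ys : List α) : (agreeOff k xs ys).cost ≤ ys.length + 1 := by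
  induction xs generalizing ys with
  | nil => cases ys <;> simp [agreeOff]
  | cons x xs ih =>
    cases ys with
    | nil => simp [agreeOff]
    | cons y ys => have := ih ys; simp [agreeOff]; omega

end Lists

/-! ### Merkle paths: recomputed roots, offsets and collisions -/

section Witnesses

variable {D : Type}

@[simp] theorem recompute_nil (H : Option D → Option D → D) (x : Option D) :
    (recompute H [] x).val = x := rfl

theorem recompute_cons (H : Option D → Option D → D) (s : Option D) (b : Bool) (w : Witness D)
    (x : Option D) : (recompute H ((s, b) :: w) x).val =
      (recompute H w (if b then combine H s x else combine H x s)).val := rfl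

/-- A witness is listed from the leaf upwards whereas trees are built from the root downwards, so
inductions over trees must split off the last sibling. `pathInputs_concat` and `pathOffset_concat`
serve the same purpose. -/
theorem recompute_concat (H : Option D → Option D → D) (w : Witness D) (s : Option D) (b : Bool)
    (x : Option D) : (recompute H (w ++ [(s, b)]) x).val =
      if b then combine H s (recompute H w x).val else combine H (recompute H w x).val s := by
  induction w generalizing x with
  | nil => cases b <;> simp [recompute]
  | cons e w ih =>
    rcases e with ⟨s', b'⟩
    simp only [List.cons_append, recompute_cons, ih]

@[simp] theorem recompute_cost (H : Option D → Option D → D) (w : Witness D) (x : Option D) :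
    (recompute H w x).cost = w.length := by
  induction w generalizing x with
  | nil => rfl
  | cons e w ih => simp [recompute, ih, add_comm]

theorem pathInputs_concat (H : Option D → Option D → D) (w : Witness D) (s : Option D) (b : Bool)
    (x : Option D) : pathInputs H (w ++ [(s, b)]) x = pathInputs H w x ++
      [if b then (s, (recompute H w x).val) else ((recompute H w x).val, s)] := by
  induction w generalizing x with
  | nil => cases b <;> simp [pathInputs]
  | cons e w ih =>
    rcases e with ⟨s', b'⟩
    simp only [List.cons_append, pathInputs, recompute_cons, ih]

@[simp] theorem length_pathInputs (H : Option D → Option D → D) (w : Witness D) (x : Option D) :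
    (pathInputs H w x).length = w.length := by
  induction w generalizing x with
  | nil => rfl
  | cons e w ih => simp [pathInputs, ih]

theorem pathOffset_concat (j : ℕ) (w : Witness D) (s : Option D) (b : Bool) :
    (pathOffset j (w ++ [(s, b)])).val =
      (pathOffset j w).val + if b then 2 ^ (j + w.length) else 0 := by
  induction w generalizing j with
  | nil => cases b <;> simp [pathOffset]
  | cons e w ih =>
    have h : j + 1 + w.length = j + (w.length + 1) := by omega
    rcases e with ⟨s', b'⟩
    cases b' <;> simp [pathOffset, ih, h, add_assoc]

@[simp] theorem pathOffset_cost (j : ℕ) (w : Witness D) : (pathOffset j w).cost = w.length := by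
  induction w generalizing j with
  | nil => rfl
  | cons e w ih => simp [pathOffset, ih, add_comm]

@[simp] theorem vecOffset_val_snd (k : ℕ) (v : List (Option D)) :
    (vecOffset k v).val.2 = v.length := by
  induction v with
  | nil => rfl
  | cons x v ih => simp [vecOffset, ih]

theorem vecOffset_cons (k : ℕ) (x : Option D) (v : List (Option D)) :
    (vecOffset k (x :: v)).val.1 =
      if k < v.length ∧ x.isSome then (vecOffset k v).val.1 + 2 ^ v.length
      else (vecOffset k v).val.1 := by
  simp [vecOffset]

@[simp] theorem vecOffset_cost (k : ℕ) (v : List (Option D)) :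
    (vecOffset k v).cost = v.length := by
  induction v with
  | nil => rfl
  | cons x v ih => simp [vecOffset, ih]

theorem assignIndex_val (v : List (Option D)) (w : Witness D) :
    (assignIndex v w).val = 1 + (vecOffset w.length v).val.1 + (pathOffset 0 w).val := by
  simp [assignIndex]

theorem assignIndex_cost (v : List (Option D)) (w : Witness D) :
    (assignIndex v w).cost = 2 * w.length + v.length := by
  simp [assignIndex]; omega

theorem directions_val (w : Witness D) : (directions w).val = (w.map Prod.snd).reverse := by
  simp [directions]

theorem directions_cost (w : Witness D) : (directions w).cost = 3 * w.length := by
  simp [directions]; omega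

theorem allEmpty_val (w : Witness D) : (allEmpty w).val = true ↔ ∀ e ∈ w, e.1 = none := by
  induction w with
  | nil => simp [allEmpty]
  | cons e w ih => simp [allEmpty, ih]

@[simp] theorem allEmpty_cost (w : Witness D) : (allEmpty w).cost = w.length := by
  induction w with
  | nil => rfl
  | cons e w ih => simp [allEmpty, ih, add_comm]

@[simp] theorem combine_none_none (H : Option D → Option D → D) : combine H none none = none := rfl

theorem combine_of_ne (H : Option D → Option D → D) {a b : Option D} (h : (a, b) ≠ (none, none)) :
    combine H a b = some (H a b) := by
  cases a <;> cases b <;> simp_all [combine]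

theorem combine_eq_none (H : Option D → Option D → D) {a b : Option D} :
    combine H a b = none ↔ a = none ∧ b = none := by
  cases a <;> cases b <;> simp [combine]

theorem recompute_none_of_allEmpty (H : Option D → Option D → D) {w : Witness D}
    (h : ∀ e ∈ w, e.1 = none) : (recompute H w none).val = none := by
  induction w with
  | nil => rfl
  | cons e w ih =>
    rcases e with ⟨s, b⟩
    simp only [List.mem_cons, forall_eq_or_imp] at h
    obtain ⟨rfl, h⟩ := h
    rw [recompute_cons]
    simpa using ih h

/-- A hash value is never `⊥`, so a `⊥` on top can only come from `⊥` at every node below. No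
collision assumption is involved. -/
theorem allEmpty_of_recompute (H : Option D → Option D → D) {w : Witness D} {x : Option D}
    (h : (recompute H w x).val = none) : x = none ∧ ∀ e ∈ w, e.1 = none := by
  induction w generalizing x with
  | nil => simpa using h
  | cons e w ih =>
    rcases e with ⟨s, b⟩
    rw [recompute_cons] at h
    obtain ⟨h1, h2⟩ := ih h
    cases b <;> simp [combine_eq_none] at h1 <;> simp_all

/-- The single place where absence of collisions is turned into an equality. The pair `(⊥, ⊥)` is
not hashed and needs its own cases: it alone gives the value `⊥`. -/
theorem combine_injective_of_not_collision {H : Option D → Option D → D}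
    {xs : List (Option D × Option D)} (hxs : ¬ CollisionIn H xs) {a b c d : Option D}
    (hab : (a, b) ∈ xs) (hcd : (c, d) ∈ xs) (h : combine H a b = combine H c d) :
    a = c ∧ b = d := by
  by_cases h1 : (a, b) = (none, none)
  · simp only [Prod.mk.injEq] at h1
    obtain ⟨rfl, rfl⟩ := h1
    have := (combine_eq_none H).1 h.symm
    exact ⟨this.1.symm, this.2.symm⟩
  · by_cases h2 : (c, d) = (none, none)
    · simp only [Prod.mk.injEq] at h2
      obtain ⟨rfl, rfl⟩ := h2
      exact (combine_eq_none H).1 h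
    · rw [combine_of_ne H h1, combine_of_ne H h2] at h
      by_contra hne
      refine hxs ⟨_, hab, _, hcd, fun he => hne ?_, h1, h2, Option.some.inj h⟩
      simpa using he

theorem CollisionIn.mono {H : Option D → Option D → D} {xs ys : List (Option D × Option D)}
    (h : CollisionIn H xs) (hs : xs ⊆ ys) : CollisionIn H ys := by
  obtain ⟨a, ha, b, hb, hab⟩ := h
  exact ⟨a, hs ha, b, hs hb, hab⟩

end Witnesses

/-! ## Positions in a single tree

A path from the root to a leaf is a list of bits, `true` for a step to the right. -/

/-- The number of leaves to the left of the leaf at the end of a path. -/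
def pathPos : List Bool → ℕ
  | [] => 0
  | b :: p => (if b then 2 ^ p.length else 0) + pathPos p

theorem pathPos_lt (p : List Bool) : pathPos p < 2 ^ p.length := by
  induction p with
  | nil => simp [pathPos]
  | cons b p ih => cases b <;> simp [pathPos, pow_succ] <;> omega

/-- A list in which no entry other than `⊥` is repeated. -/
def Uniq {D : Type} (xs : List (Option D)) : Prop := xs.Pairwise fun a b => a = b → a = none

theorem idxOf?_append {α : Type} [BEq α] (a : α) (xs ys : List α) :
    (xs ++ ys).idxOf? a = (xs.idxOf? a).or ((ys.idxOf? a).map (· + xs.length)) := by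
  simp [List.idxOf?, List.findIdx?_append]

namespace MTree

variable {D : Type}

/-- The leaf at the end of a path. -/
def get : {k : ℕ} → MTree D k → List Bool → Option D
  | _, leaf x, _ => x
  | _, node _ _, [] => none
  | _, node l r, b :: p => if b then get r p else get l p

/-- Overwrite the leaf at the end of a path. -/
def set (v : Option D) : {k : ℕ} → MTree D k → List Bool → MTree D k
  | _, leaf _, _ => leaf v
  | _, node l r, [] => node l r
  | _, node l r, b :: p => if b then node l (set v r p) else node (set v l p) r

/-- The Merkle path of the leaf at the end of a path. -/
def path (H : Option D → Option D → D) : {k : ℕ} → MTree D k → List Bool → Witness D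
  | _, leaf _, _ => []
  | _, node _ _, [] => []
  | _, node l r, b :: p =>
    if b then path H r p ++ [(root H l, true)] else path H l p ++ [(root H r, false)]

/-- The occupancy of a tree. -/
def occ : {k : ℕ} → MTree D k → Occ
  | _, leaf x => if x.isSome then Occ.full else Occ.empty
  | _, node l r => Occ.join (occ l) (occ r)

theorem length_leaves {k : ℕ} (t : MTree D k) : t.leaves.length = 2 ^ k := by
  induction t with
  | leaf x => rfl
  | node l r hl hr => simp [leaves, hl, hr, pow_succ, mul_two]

theorem leaves_ne_nil {k : ℕ} (t : MTree D k) : t.leaves ≠ [] := by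
  rw [← List.length_pos_iff, length_leaves]
  positivity

theorem leaves_empty (k : ℕ) : (empty k : MTree D k).leaves = List.replicate (2 ^ k) none := by
  induction k with
  | zero => rfl
  | succ k ih => rw [empty, leaves, ih, List.replicate_append_replicate, pow_succ, mul_two]

theorem root_empty (H : Option D → Option D → D) (k : ℕ) : (empty k).root H = none := by
  induction k with
  | zero => rfl
  | succ k ih => simp [empty, root, ih]

theorem occ_empty (k : ℕ) : (empty k : MTree D k).occ = Occ.empty := by
  induction k with
  | zero => rfl
  | succ k ih => simp [empty, occ, ih, Occ.join]

theorem root_eq_none {H : Option D → Option D → D} {k : ℕ} {t : MTree D k} :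
    t.root H = none ↔ ∀ x ∈ t.leaves, x = none := by
  induction t with
  | leaf x => simp [root, leaves]
  | node l r hl hr => simp only [root, combine_eq_none, hl, hr, leaves, List.mem_append, or_imp,
      forall_and]

theorem length_path (H : Option D → Option D → D) {k : ℕ} (t : MTree D k) {p : List Bool}
    (hp : p.length = k) : (t.path H p).length = k := by
  induction t generalizing p with
  | leaf x => rfl
  | node l r hl hr =>
    obtain _ | ⟨b, p⟩ := p
    · simp at hp
    · simp only [List.length_cons, Nat.add_right_cancel_iff] at hp
      cases b <;> simp [path, hl hp, hr hp]

theorem directions_path (H : Option D → Option D → D) {k : ℕ} (t : MTree D k) {p : List Bool}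
    (hp : p.length = k) : ((t.path H p).map Prod.snd).reverse = p := by
  induction t generalizing p with
  | leaf x => simp [path, List.length_eq_zero_iff.1 hp]
  | node l r hl hr =>
    obtain _ | ⟨b, p⟩ := p
    · simp at hp
    · simp only [List.length_cons, Nat.add_right_cancel_iff] at hp
      cases b
      · simpa [path] using hl hp
      · simpa [path] using hr hp

/-- Each step to the right leaves a left sibling on the witness, and a sibling at level `j` has `2 ^
j` leaves; both sides count the leaves to the left. -/
theorem pathOffset_path (H : Option D → Option D → D) {k : ℕ} (t : MTree D k) {p : List Bool}
    (hp : p.length = k) : (pathOffset 0 (t.path H p)).val = pathPos p := by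
  induction t generalizing p with
  | leaf x => simp [path, List.length_eq_zero_iff.1 hp, pathOffset, pathPos]
  | node l r hl hr =>
    obtain _ | ⟨b, p⟩ := p
    · simp at hp
    · simp only [List.length_cons, Nat.add_right_cancel_iff] at hp
      cases b
      · simp [path, pathOffset_concat, hl hp, pathPos]
      · simp [path, pathOffset_concat, hr hp, pathPos, length_path H r hp, hp, add_comm]

/-- The siblings lie off the path, so overwriting the leaf does not affect them. Hence one witness
certifies both the old and the new root. -/
theorem recompute_path (H : Option D → Option D → D) {k : ℕ} (t : MTree D k) {p : List Bool}
    (hp : p.length = k) (v : Option D) : (recompute H (t.path H p) v).val = (t.set v p).root H := by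
  induction t generalizing p with
  | leaf x => rfl
  | node l r hl hr =>
    obtain _ | ⟨b, p⟩ := p
    · simp at hp
    · simp only [List.length_cons, Nat.add_right_cancel_iff] at hp
      cases b
      · simp [path, set, root, recompute_concat, hl hp]
      · simp [path, set, root, recompute_concat, hr hp]

theorem path_set (H : Option D → Option D → D) {k : ℕ} (t : MTree D k) (p : List Bool)
    (v : Option D) : (t.set v p).path H p = t.path H p := by
  induction t generalizing p with
  | leaf x => rfl
  | node l r hl hr =>
    obtain _ | ⟨b, p⟩ := p
    · rfl
    · cases b <;> simp [path, set, hl, hr]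

theorem set_get {k : ℕ} (t : MTree D k) (p : List Bool) : t.set (t.get p) p = t := by
  induction t generalizing p with
  | leaf x => rfl
  | node l r hl hr =>
    obtain _ | ⟨b, p⟩ := p
    · rfl
    · cases b <;> simp [get, set, hl, hr]

theorem get_set {k : ℕ} (t : MTree D k) {p : List Bool} (hp : p.length = k) (v : Option D) :
    (t.set v p).get p = v := by
  induction t generalizing p with
  | leaf x => rfl
  | node l r hl hr =>
    obtain _ | ⟨b, p⟩ := p
    · simp at hp
    · simp only [List.length_cons, Nat.add_right_cancel_iff] at hp
      cases b <;> simp [get, set, hl hp, hr hp]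

theorem leaves_set {k : ℕ} (t : MTree D k) {p : List Bool} (hp : p.length = k) (v : Option D) :
    (t.set v p).leaves = t.leaves.set (pathPos p) v := by
  induction t generalizing p with
  | leaf x => simp [set, leaves, List.length_eq_zero_iff.1 hp, pathPos]
  | node l r hl hr =>
    obtain _ | ⟨b, p⟩ := p
    · simp at hp
    · simp only [List.length_cons, Nat.add_right_cancel_iff] at hp
      have := pathPos_lt p
      have h2 := l.length_leaves
      cases b
      · rw [leaves, List.set_append, if_pos (by simp [pathPos, h2, ← hp, this])]
        simp [set, leaves, hl hp, pathPos]
      · rw [leaves, List.set_append, if_neg (by simp [pathPos, h2, hp])]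
        simp [set, leaves, hr hp, pathPos, h2, hp]

/-- Overwriting a leaf by its own content changes nothing, so reading at a position follows from
writing at it (`leaves_set`). -/
theorem leaves_getElem? {k : ℕ} (t : MTree D k) {p : List Bool} (hp : p.length = k) :
    t.leaves[pathPos p]? = some (t.get p) := by
  have h := t.leaves_set hp (t.get p)
  rw [set_get] at h
  rw [h, List.getElem?_set_self]
  rw [length_leaves, ← hp]
  exact pathPos_lt p

theorem get_mem_leaves {k : ℕ} (t : MTree D k) {p : List Bool} (hp : p.length = k) :
    t.get p ∈ t.leaves :=
  List.mem_of_getElem? (t.leaves_getElem? hp)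

/-- Without a collision, a witness that recomputes the root is the Merkle path of a leaf. -/
theorem path_of_recompute {H : Option D → Option D → D} {k : ℕ} (t : MTree D k) {w : Witness D}
    {v : Option D} (hw : w.length = k) (h : (recompute H w v).val = t.root H)
    (hc : ¬ CollisionIn H (t.hashInputs H ++ pathInputs H w v)) :
    w = t.path H (w.map Prod.snd).reverse ∧ t.get (w.map Prod.snd).reverse = v := by
  induction t generalizing w with
  | leaf x =>
    obtain rfl := List.length_eq_zero_iff.1 hw
    exact ⟨rfl, h.symm⟩
  | node l r hl hr =>
    -- The last sibling belongs to the root. Injectivity of `combine` identifies it with the root of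
    -- one child and the value recomputed below it with the root of the other, to which the
    -- induction hypothesis applies.
    obtain rfl | ⟨w, ⟨s, b⟩, rfl⟩ := List.eq_nil_or_concat' w
    · simp at hw
    simp only [List.length_append, List.length_singleton, Nat.add_right_cancel_iff] at hw
    rw [recompute_concat, root] at h
    rw [pathInputs_concat] at hc
    cases b
    · simp only [Bool.false_eq_true, if_false] at h hc
      obtain ⟨h1, h2⟩ := combine_injective_of_not_collision hc (by simp) (by simp [hashInputs]) h
      obtain ⟨h3, h4⟩ := hl hw h1 fun hc' => hc (hc'.mono (by
        simp only [hashInputs]; intro z; simp; tauto))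
      simp only [List.map_append, List.map_cons, List.map_nil, List.reverse_append,
        List.reverse_cons, List.reverse_nil, List.nil_append, List.cons_append, path, get,
        Bool.false_eq_true, if_false]
      exact ⟨by rw [← h3, h2], h4⟩
    · simp only [if_true] at h hc
      obtain ⟨h1, h2⟩ := combine_injective_of_not_collision hc (by simp) (by simp [hashInputs]) h
      obtain ⟨h3, h4⟩ := hr hw h2 fun hc' => hc (hc'.mono (by
        simp only [hashInputs]; intro z; simp; tauto))
      simp only [List.map_append, List.map_cons, List.map_nil, List.reverse_append,
        List.reverse_cons, List.reverse_nil, List.nil_append, List.cons_append, path, get,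
        if_true]
      exact ⟨by rw [← h3, h1], h4⟩

theorem length_hashInputs (H : Option D → Option D → D) {k : ℕ} (t : MTree D k) :
    (t.hashInputs H).length + 1 = 2 ^ k := by
  induction t with
  | leaf x => rfl
  | node l r hl hr => simp [hashInputs, pow_succ]; omega

variable [DecidableEq D]

/-- The path to the first leaf with content `y`. -/
def find (y : Option D) : {k : ℕ} → MTree D k → Option (List Bool)
  | _, leaf x => if x = y then some [] else none
  | _, node l r =>
    match find y l with
    | some p => some (false :: p)
    | none => (find y r).map (true :: ·)

theorem length_of_find {y : Option D} {k : ℕ} {t : MTree D k} {p : List Bool}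
    (h : t.find y = some p) : p.length = k := by
  induction t generalizing p with
  | leaf x => simp only [find, Option.ite_none_right_eq_some, Option.some.injEq] at h; simp [← h.2]
  | node l r hl hr =>
    rw [find] at h
    cases hf : l.find y with
    | some q => rw [hf] at h; simp only [Option.some.injEq] at h; simp [← h, hl hf]
    | none =>
      rw [hf] at h
      obtain ⟨q, hq, rfl⟩ := Option.map_eq_some_iff.1 h
      simp [hr hq]

theorem find_pos (y : Option D) {k : ℕ} (t : MTree D k) :
    (t.find y).map pathPos = t.leaves.idxOf? y := by
  induction t with
  | leaf x => by_cases h : x = y <;> simp [find, leaves, List.idxOf?_cons, h, pathPos]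
  | node l r hl hr =>
    rw [find, leaves, idxOf?_append, ← hl, ← hr, length_leaves]
    cases hf : l.find y with
    | some q => simp [pathPos]
    | none =>
      cases hf' : r.find y with
      | none => simp
      | some q => simp [pathPos, length_of_find hf', add_comm]

theorem find_eq_none {y : Option D} {k : ℕ} {t : MTree D k} : t.find y = none ↔ y ∉ t.leaves := by
  rw [← List.idxOf?_eq_none_iff, ← find_pos, Option.map_eq_none_iff]

theorem get_of_find {y : Option D} {k : ℕ} {t : MTree D k} {p : List Bool}
    (h : t.find y = some p) : t.get p = y := by
  induction t generalizing p with
  | leaf x => simp only [find, Option.ite_none_right_eq_some] at h; simp [get, h.1]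
  | node l r hl hr =>
    rw [find] at h
    cases hf : l.find y with
    | some q => rw [hf] at h; simp only [Option.some.injEq] at h; simp [← h, get, hl hf]
    | none =>
      rw [hf] at h
      obtain ⟨q, hq, rfl⟩ := Option.map_eq_some_iff.1 h
      simp [get, hr hq]

/-- `find` returns the first occurrence; since an FID occurs at most once, this is any occurrence.
-/
theorem find_of_get {x : D} {k : ℕ} {t : MTree D k} {p : List Bool} (hu : Uniq t.leaves)
    (hp : p.length = k) (h : t.get p = some x) : t.find (some x) = some p := by
  induction t generalizing p with
  | leaf y => simp only [get] at h; simp [find, h, List.length_eq_zero_iff.1 hp]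
  | node l r hl hr =>
    obtain _ | ⟨b, p⟩ := p
    · simp at hp
    simp only [List.length_cons, Nat.add_right_cancel_iff] at hp
    obtain ⟨h1, h2, h3⟩ := List.pairwise_append.1 hu
    cases b
    · simp [find, hl h1 hp h]
    · have hn : l.find (some x) = none := by
        rw [find_eq_none]
        intro hm
        have hg : r.get p = some x := h
        simpa using h3 _ hm _ (hg ▸ r.get_mem_leaves hp) rfl
      simp [find, hn, hr h2 hp h]

/-- The recursive operations are reduced to addresses here, in `witness_eq` and in `erase_of_find`;
afterwards only `find`, `set` and `path` matter. -/
theorem insert_eq (x : D) {k : ℕ} (t : MTree D k) :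
    t.insert x = (t.find none).map (t.set (some x)) := by
  induction t with
  | leaf y => cases y <;> simp [insert, find, set]
  | node l r hl hr =>
    rw [insert, find, hl, hr]
    cases l.find none with
    | some q => simp [set]
    | none => cases r.find none <;> simp [set]

theorem witness_eq (H : Option D → Option D → D) (x : D) {k : ℕ} (t : MTree D k) :
    t.witness H x = (t.find (some x)).map (t.path H) := by
  induction t with
  | leaf y => by_cases h : y = some x <;> simp [witness, find, path, h]
  | node l r hl hr =>
    rw [witness, find, hl, hr]
    cases l.find (some x) with
    | some q => simp [path]
    | none => cases r.find (some x) <;> simp [path]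

theorem erase_of_notMem {x : D} {k : ℕ} {t : MTree D k} (h : some x ∉ t.leaves) :
    t.erase x = t := by
  induction t with
  | leaf y => simp only [leaves, List.mem_singleton] at h; simp [erase, Ne.symm h]
  | node l r hl hr =>
    simp only [leaves, List.mem_append, not_or] at h
    rw [erase, hl h.1, hr h.2]

/-- `erase` clears every leaf that stores `x`; uniqueness says that there is only this one. -/
theorem erase_of_find {x : D} {k : ℕ} {t : MTree D k} {p : List Bool} (hu : Uniq t.leaves)
    (h : t.find (some x) = some p) : t.erase x = t.set none p := by
  induction t generalizing p with
  | leaf y => simp only [find, Option.ite_none_right_eq_some] at h; simp [erase, set, h.1]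
  | node l r hl hr =>
    obtain ⟨h1, h2, h3⟩ := List.pairwise_append.1 hu
    rw [find] at h
    cases hf : l.find (some x) with
    | some q =>
      rw [hf] at h
      simp only [Option.some.injEq] at h
      have hn : some x ∉ r.leaves := fun hm => by
        have hm' := l.get_mem_leaves (length_of_find hf)
        rw [get_of_find hf] at hm'
        simpa using h3 _ hm' _ hm rfl
      rw [erase, hl h1 hf, erase_of_notMem hn, ← h]
      simp [set]
    | none =>
      rw [hf] at h
      obtain ⟨q, hq, rfl⟩ := Option.map_eq_some_iff.1 h
      rw [erase, erase_of_notMem (find_eq_none.1 hf), hr h2 hq]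
      simp [set]

end MTree

/-! ### Occupancy trees kept by the verifier -/

namespace Occ

@[simp] theorem left_join (a b : Occ) : (join a b).left = a := by cases a <;> cases b <;> rfl

@[simp] theorem right_join (a b : Occ) : (join a b).right = b := by cases a <;> cases b <;> rfl

@[simp] theorem isFull_join (a b : Occ) : (join a b).isFull = (a.isFull && b.isFull) := by
  cases a <;> cases b <;> rfl

theorem fill_cost_le (k : ℕ) (o : Occ) : (fill k o).cost ≤ k + 1 := by
  induction k generalizing o with
  | zero => simp [fill]
  | succ k ih =>
    have h1 := ih o.left
    have h2 := ih o.right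
    rw [fill, cost_bind, cost_tick]
    split_ifs
    · simp
    · simp; omega
    · simp; omega

/-- The normal form shows at the root that a tree is full. Without this, searching through the full
trees of a forest would cost quadratically many steps in the length of the vector. -/
theorem fill_cost_of_isFull (k : ℕ) {o : Occ} (h : o.isFull = true) : (fill k o).cost = 1 := by
  cases k <;> simp [fill, h]

theorem clear_cost (p : List Bool) (o : Occ) : (clear p o).cost = p.length + 1 := by
  induction p generalizing o with
  | nil => rfl
  | cons b p ih => cases b <;> simp [clear, ih] <;> omega

end Occ

namespace MTree

variable {D : Type}

theorem clear_occ {k : ℕ} (t : MTree D k) {p : List Bool} (hp : p.length = k) :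
    (t.occ.clear p).val = (t.set none p).occ := by
  induction t generalizing p with
  | leaf x => simp [List.length_eq_zero_iff.1 hp, Occ.clear, set, occ]
  | node l r hl hr =>
    obtain _ | ⟨b, p⟩ := p
    · simp at hp
    · simp only [List.length_cons, Nat.add_right_cancel_iff] at hp
      cases b <;> simp [Occ.clear, occ, set, hl hp, hr hp]

variable [DecidableEq D]

theorem isFull_occ {k : ℕ} (t : MTree D k) : t.occ.isFull = true ↔ t.find none = none := by
  rw [find_eq_none]
  induction t with
  | leaf x => cases x <;> simp [occ, Occ.isFull, leaves]
  | node l r hl hr => simp [occ, hl, hr, leaves]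

/-- Stated without the FID that `fill_occ` takes, because the cost bound `fill_occs_cost_le` has
none at hand. -/
theorem find_eq_none_of_fill {k : ℕ} (t : MTree D k) (h : (t.occ.fill k).val = none) :
    t.find none = none := by
  induction t with
  | leaf y => cases y <;> simp_all [occ, Occ.fill, find, Occ.isFull]
  | node l r hl hr =>
    rw [occ, Occ.fill, val_bind] at h
    have h1 := l.isFull_occ
    have h2 := r.isFull_occ
    cases hl' : l.occ.isFull <;> cases hr' : r.occ.isFull <;> simp_all [find]

/-- Which leaf is filled depends on the occupancy alone, so the verifier finds the prescribed
position without knowing any FID. `clear_occ` is the counterpart for deletions. -/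
theorem fill_occ {k : ℕ} (t : MTree D k) (x : D) :
    (t.occ.fill k).val = (t.find none).map fun p => (p, (t.set (some x) p).occ) := by
  induction t with
  | leaf y => cases y <;> simp [occ, Occ.fill, find, Occ.isFull, set]
  | node l r hl hr =>
    rw [Occ.fill, val_bind, find]
    have h1 := l.isFull_occ
    have h2 := r.isFull_occ
    cases hf : l.find none with
    | some p =>
      have : l.occ.isFull = false := by simpa [hf] using h1
      simp [occ, this, hl, hf, set]
    | none =>
      have : l.occ.isFull = true := by simpa [hf] using h1
      cases hf' : r.find none with
      | none =>
        have h3 : r.occ.isFull = true := by simpa [hf'] using h2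
        simp [occ, this, h3]
      | some p =>
        have h3 : r.occ.isFull = false := by simpa [hf'] using h2
        simp [occ, this, h3, hr, hf', set]

end MTree

/-! ## Positions in a forest

A leaf of a forest is addressed by the depth of its tree and a path in that tree. -/

/-- The number of leaves of the trees of depths `k + 1, …, m - 1`. -/
def treeOffset (m k : ℕ) : ℕ := ∑ j ∈ Finset.Ico (k + 1) m, 2 ^ j

theorem treeOffset_of_le {m k : ℕ} (h : m ≤ k + 1) : treeOffset m k = 0 := by
  simp [treeOffset, Finset.Ico_eq_empty_of_le h]

theorem treeOffset_succ {m k : ℕ} (h : k < m) : treeOffset (m + 1) k = treeOffset m k + 2 ^ m :=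
  Finset.sum_Ico_succ_top h _

theorem vecOffset_of_le {D : Type} {k : ℕ} {v : List (Option D)} (h : v.length ≤ k + 1) :
    (vecOffset k v).val.1 = 0 := by
  induction v with
  | nil => rfl
  | cons x v ih =>
    simp only [List.length_cons] at h
    rw [vecOffset_cons, if_neg (by omega), ih (by omega)]

theorem Occ.eq_full {o : Occ} (h : o.isFull = true) : o = Occ.full := by
  cases o <;> simp_all [isFull]

namespace Forest

variable {D : Type}

/-- The leaf at the end of a path in the tree of depth `k`. -/
def get : {m : ℕ} → Forest D m → ℕ → List Bool → Option D
  | _, nil, _, _ => none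
  | _, cons (m := m) t rest, k, p => if m = k then t.get p else get rest k p

/-- Overwrite the leaf at the end of a path in the tree of depth `k`. -/
def set (v : Option D) : {m : ℕ} → Forest D m → ℕ → List Bool → Forest D m
  | _, nil, _, _ => nil
  | _, cons (m := m) t rest, k, p =>
    if m = k then cons (t.set v p) rest else cons t (set v rest k p)

/-- The Merkle path of the leaf at the end of a path in the tree of depth `k`. -/
def path (H : Option D → Option D → D) : {m : ℕ} → Forest D m → ℕ → List Bool → Witness D
  | _, nil, _, _ => []
  | _, cons (m := m) t rest, k, p => if m = k then t.path H p else path H rest k p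

/-- The occupancies of the trees. -/
def occs : {m : ℕ} → Forest D m → List Occ
  | _, nil => []
  | _, cons t rest => t.occ :: occs rest

@[simp] theorem length_roots (H : Option D → Option D → D) {m : ℕ} (F : Forest D m) :
    (F.roots H).length = m := by
  induction F with
  | nil => rfl
  | cons t rest ih => simp [roots, ih]

@[simp] theorem length_occs {m : ℕ} (F : Forest D m) : F.occs.length = m := by
  induction F with
  | nil => rfl
  | cons t rest ih => simp [occs, ih]

theorem length_leaves {m : ℕ} (F : Forest D m) : F.leaves.length + 1 = 2 ^ m := by
  induction F with
  | nil => rfl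
  | cons t rest ih => simp [leaves, t.length_leaves, pow_succ]; omega

theorem leaves_empty (m : ℕ) :
    (empty m : Forest D m).leaves = List.replicate (2 ^ m - 1) none := by
  induction m with
  | zero => rfl
  | succ m ih =>
    rw [empty, leaves, ih, MTree.leaves_empty, List.replicate_append_replicate, pow_succ]
    congr 1
    have := Nat.one_le_two_pow (n := m)
    omega

theorem roots_empty (H : Option D → Option D → D) (m : ℕ) :
    (empty m).roots H = List.replicate m none := by
  induction m with
  | zero => rfl
  | succ m ih => rw [empty, roots, ih, MTree.root_empty, List.replicate_succ]

theorem occs_empty (m : ℕ) : (empty m : Forest D m).occs = List.replicate m Occ.empty := by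
  induction m with
  | zero => rfl
  | succ m ih => rw [empty, occs, ih, MTree.occ_empty, List.replicate_succ]

theorem length_path (H : Option D → Option D → D) {m k : ℕ} (F : Forest D m) {p : List Bool}
    (hk : k < m) (hp : p.length = k) : (F.path H k p).length = k := by
  induction F with
  | nil => omega
  | @cons m t rest ih =>
    rw [path]
    split_ifs with h
    · exact h ▸ t.length_path H (hp.trans h.symm)
    · exact ih (by omega)

theorem directions_path (H : Option D → Option D → D) {m k : ℕ} (F : Forest D m) {p : List Bool}
    (hk : k < m) (hp : p.length = k) : ((F.path H k p).map Prod.snd).reverse = p := by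
  induction F with
  | nil => omega
  | @cons m t rest ih =>
    rw [path]
    split_ifs with h
    · exact t.directions_path H (hp.trans h.symm)
    · exact ih (by omega)

theorem pathOffset_path (H : Option D → Option D → D) {m k : ℕ} (F : Forest D m) {p : List Bool}
    (hk : k < m) (hp : p.length = k) : (pathOffset 0 (F.path H k p)).val = pathPos p := by
  induction F with
  | nil => omega
  | @cons m t rest ih =>
    rw [path]
    split_ifs with h
    · exact t.pathOffset_path H (hp.trans h.symm)
    · exact ih (by omega)

theorem roots_set (H : Option D → Option D → D) {m k : ℕ} (F : Forest D m) {p : List Bool}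
    (hp : p.length = k) (v : Option D) :
    (F.set v k p).roots H = replaceEntry k (recompute H (F.path H k p) v).val (F.roots H) := by
  induction F with
  | nil => rfl
  | @cons m t rest ih =>
    rw [path, set]
    split_ifs with h
    · simp [roots, replaceEntry, h, t.recompute_path H (hp.trans h.symm)]
    · simp [roots, replaceEntry, h, ih]

theorem path_set (H : Option D → Option D → D) {m : ℕ} (F : Forest D m) (k : ℕ) (p : List Bool)
    (v : Option D) : (F.set v k p).path H k p = F.path H k p := by
  induction F with
  | nil => rfl
  | @cons m t rest ih =>
    rw [path, set]
    split_ifs with h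
    · simp [path, h, MTree.path_set]
    · simp [path, h, ih]

theorem set_get {m : ℕ} (F : Forest D m) (k : ℕ) (p : List Bool) :
    F.set (F.get k p) k p = F := by
  induction F with
  | nil => rfl
  | @cons m t rest ih =>
    rw [get, set]
    split_ifs with h
    · rw [t.set_get]
    · rw [ih]

theorem get_set {m k : ℕ} (F : Forest D m) {p : List Bool} (hk : k < m) (hp : p.length = k)
    (v : Option D) : (F.set v k p).get k p = v := by
  induction F with
  | nil => omega
  | @cons m t rest ih =>
    rw [set]
    split_ifs with h
    · simp [get, h, t.get_set (hp.trans h.symm)]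
    · simp [get, h, ih (show k < m by omega)]

theorem leaves_set {m k : ℕ} (F : Forest D m) {p : List Bool} (hk : k < m) (hp : p.length = k)
    (v : Option D) : (F.set v k p).leaves = F.leaves.set (treeOffset m k + pathPos p) v := by
  induction F with
  | nil => omega
  | @cons m t rest ih =>
    rw [set]
    split_ifs with h
    · subst h
      have := pathPos_lt p
      rw [leaves, leaves, t.leaves_set hp, treeOffset_of_le le_rfl, List.set_append,
        if_pos (by rw [t.length_leaves, ← hp]; omega), zero_add]
    · have hk' : k < m := by omega
      rw [leaves, leaves, ih hk', treeOffset_succ hk', List.set_append,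
        if_neg (by rw [t.length_leaves]; omega), t.length_leaves]
      congr 2
      omega

theorem pos_lt {m k : ℕ} {p : List Bool} (hk : k < m) (hp : p.length = k) :
    treeOffset m k + pathPos p < 2 ^ m - 1 := by
  induction m with
  | zero => omega
  | succ m ih =>
    have := pathPos_lt p
    have h1 := Nat.one_le_two_pow (n := m)
    rw [pow_succ]
    by_cases h : m = k
    · subst h
      rw [treeOffset_of_le le_rfl, ← hp]
      rw [← hp] at h1
      omega
    · have := ih (by omega)
      rw [treeOffset_succ (by omega)]
      omega

theorem leaves_getElem? {m k : ℕ} (F : Forest D m) {p : List Bool} (hk : k < m)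
    (hp : p.length = k) : F.leaves[treeOffset m k + pathPos p]? = some (F.get k p) := by
  have h := F.leaves_set hk hp (F.get k p)
  rw [set_get] at h
  rw [h, List.getElem?_set_self]
  have := F.length_leaves
  have := pos_lt hk hp
  omega

theorem get_mem_leaves {m k : ℕ} (F : Forest D m) {p : List Bool} (hk : k < m)
    (hp : p.length = k) : F.get k p ∈ F.leaves :=
  List.mem_of_getElem? (F.leaves_getElem? hk hp)

theorem entry_roots (H : Option D → Option D → D) {m k : ℕ} (F : Forest D m) {p : List Bool}
    (hk : k < m) (hp : p.length = k) :
    (entry k (F.roots H)).val.1 = some (recompute H (F.path H k p) (F.get k p)).val := by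
  have h := F.roots_set H hp (F.get k p)
  rw [set_get] at h
  rw [h, entry_replaceEntry]
  simpa using hk

/-- Without a collision, a witness that recomputes the root of a tree is the Merkle path of a leaf. -/
theorem path_of_recompute {H : Option D → Option D → D} {m : ℕ} (F : Forest D m) {w : Witness D}
    {v : Option D} (h : (entry w.length (F.roots H)).val.1 = some (recompute H w v).val)
    (hc : ¬ CollisionIn H (F.hashInputs H ++ pathInputs H w v)) :
    w = F.path H w.length (w.map Prod.snd).reverse ∧
      F.get w.length (w.map Prod.snd).reverse = v := by
  induction F with
  | nil => simp [roots] at h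
  | @cons m t rest ih =>
    rw [roots, entry_cons, length_roots] at h
    rw [path, get]
    split_ifs at h ⊢ with hm
    · exact t.path_of_recompute hm.symm (Option.some.inj h).symm fun hc' => hc (hc'.mono (by
        intro z; simp [hashInputs]; tauto))
    · exact ih h fun hc' => hc (hc'.mono (by intro z; simp [hashInputs]; tauto))

theorem length_hashInputs_le (H : Option D → Option D → D) {m : ℕ} (F : Forest D m) :
    (F.hashInputs H).length + 1 ≤ 2 ^ m := by
  induction F with
  | nil => simp [hashInputs]
  | cons t rest ih =>
    have := t.length_hashInputs H
    simp only [hashInputs, List.length_append, pow_succ]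
    omega

theorem leaves_merge (x : D) {m : ℕ} (F : Forest D m) :
    (F.merge x).leaves = F.leaves ++ [some x] := by
  induction F with
  | nil => rfl
  | cons t rest ih => simp [merge, MTree.leaves, leaves, ih]

theorem path_merge (H : Option D → Option D → D) (x : D) {m : ℕ} (F : Forest D m) :
    (F.merge x).path H (List.replicate m true) = ((F.roots H).map fun r => (r, true)).reverse := by
  induction F with
  | nil => rfl
  | cons t rest ih => simp [merge, MTree.path, roots, List.replicate_succ, ih]

theorem get_merge (x : D) {m : ℕ} (F : Forest D m) :
    (F.merge x).get (List.replicate m true) = some x := by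
  induction F with
  | nil => rfl
  | cons t rest ih => simp [merge, MTree.get, List.replicate_succ, ih]

theorem clear_occs {m : ℕ} (F : Forest D m) {k : ℕ} {p : List Bool} (hp : p.length = k) :
    (occClear k p F.occs).val = ((F.set none k p).occs, m) := by
  induction F with
  | nil => rfl
  | @cons m t rest ih =>
    rw [occs, occClear, val_bind, ih, set]
    by_cases h : m = k
    · simp only [h, val_bind, if_true, occs, val_pure, t.clear_occ (hp.trans h.symm)]
      simp only [Prod.mk.injEq, and_true, List.cons.injEq, true_and]
      subst h
      clear ih
      -- The induction hypothesis describes the tail by a `set` at depth `m`, but all trees there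
      -- are smaller, so nothing happens to them.
      have : ∀ {n : ℕ} (G : Forest D n), n ≤ m → G.set none m p = G := by
        intro n G
        induction G with
        | nil => intro _; rfl
        | @cons n t rest ih => intro hn; rw [set, if_neg (by omega), ih (by omega)]
      rw [this rest le_rfl]
    · simp [h, occs]

end Forest

theorem occClear_val_snd (k : ℕ) (p : List Bool) (os : List Occ) :
    (occClear k p os).val.2 = os.length := by
  induction os with
  | nil => rfl
  | cons o os ih => by_cases h : os.length = k <;> simp [occClear, ih, h]

/-- At most one tree has depth `k`, so the path is walked at most once; the conditional term keeps
track of whether that has happened. -/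
theorem occClear_cost_le (k : ℕ) (p : List Bool) (os : List Occ) :
    (occClear k p os).cost ≤ os.length + if k < os.length then p.length + 1 else 0 := by
  induction os with
  | nil => simp [occClear]
  | cons o os ih =>
    by_cases h : os.length = k
    · simp [occClear, occClear_val_snd, h, Occ.clear_cost] at ih ⊢
      omega
    · simp only [occClear, cost_bind, cost_tick, occClear_val_snd, h, if_false, cost_pure,
        List.length_cons]
      split_ifs at ih ⊢ <;> omega

namespace Forest

variable {D : Type} [DecidableEq D]

/-- The address of the first leaf with content `y`. -/
def find (y : Option D) : {m : ℕ} → Forest D m → Option (ℕ × List Bool)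
  | _, nil => none
  | _, cons (m := m) t rest =>
    match t.find y with
    | some p => some (m, p)
    | none => find y rest

theorem of_find {y : Option D} {m : ℕ} {F : Forest D m} {k : ℕ} {p : List Bool}
    (h : F.find y = some (k, p)) : k < m ∧ p.length = k ∧ F.get k p = y := by
  induction F with
  | nil => simp [find] at h
  | @cons m t rest ih =>
    rw [find] at h
    cases hf : t.find y with
    | some q =>
      rw [hf] at h
      simp only [Option.some.injEq, Prod.mk.injEq] at h
      obtain ⟨rfl, rfl⟩ := h
      exact ⟨Nat.lt_succ_self _, MTree.length_of_find hf, by simp [get, MTree.get_of_find hf]⟩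
    | none =>
      rw [hf] at h
      obtain ⟨h1, h2, h3⟩ := ih h
      exact ⟨by omega, h2, by rw [get, if_neg (by omega), h3]⟩

theorem find_pos (y : Option D) {m : ℕ} (F : Forest D m) :
    (F.find y).map (fun z => treeOffset m z.1 + pathPos z.2) = F.leaves.idxOf? y := by
  induction F with
  | nil => simp [find, leaves, List.idxOf?]
  | @cons m t rest ih =>
    rw [find, leaves, idxOf?_append, ← ih, ← MTree.find_pos, t.length_leaves]
    cases hf : t.find y with
    | some q => simp [treeOffset_of_le]
    | none =>
      cases hf' : rest.find y with
      | none => simp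
      | some z =>
        simp [treeOffset_succ (of_find hf').1]
        omega

theorem find_eq_none {y : Option D} {m : ℕ} {F : Forest D m} :
    F.find y = none ↔ y ∉ F.leaves := by
  rw [← List.idxOf?_eq_none_iff, ← find_pos, Option.map_eq_none_iff]

theorem find_of_get {x : D} {m k : ℕ} {F : Forest D m} {p : List Bool} (hu : Uniq F.leaves)
    (hk : k < m) (hp : p.length = k) (h : F.get k p = some x) : F.find (some x) = some (k, p) := by
  induction F with
  | nil => omega
  | @cons m t rest ih =>
    obtain ⟨h1, h2, h3⟩ := List.pairwise_append.1 hu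
    rw [get] at h
    split_ifs at h with hm
    · simp [find, MTree.find_of_get h1 (hp.trans hm.symm) h, hm]
    · have hk' : k < m := by omega
      have hn : t.find (some x) = none := by
        rw [MTree.find_eq_none]
        intro hmem
        simpa using h3 _ hmem _ (h ▸ rest.get_mem_leaves hk' hp) rfl
      rw [find, hn]
      exact ih h2 hk' h

theorem insert_eq (x : D) {m : ℕ} (F : Forest D m) :
    F.insert x = (F.find none).map fun z => F.set (some x) z.1 z.2 := by
  induction F with
  | nil => rfl
  | @cons m t rest ih =>
    rw [insert, find, t.insert_eq, ih]
    cases t.find none with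
    | some q => simp [set]
    | none =>
      cases hf : rest.find none with
      | none => simp
      | some z => simp [set, (of_find hf).1.ne']

theorem witness_eq (H : Option D → Option D → D) (x : D) {m : ℕ} (F : Forest D m) :
    F.witness H x = (F.find (some x)).map fun z => F.path H z.1 z.2 := by
  induction F with
  | nil => rfl
  | @cons m t rest ih =>
    rw [witness, find, t.witness_eq, ih]
    cases t.find (some x) with
    | some q => simp [path]
    | none =>
      cases hf : rest.find (some x) with
      | none => simp
      | some z => simp [path, (of_find hf).1.ne']

theorem erase_of_notMem {x : D} {m : ℕ} {F : Forest D m} (h : some x ∉ F.leaves) :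
    F.erase x = F := by
  induction F with
  | nil => rfl
  | cons t rest ih =>
    simp only [leaves, List.mem_append, not_or] at h
    rw [erase, MTree.erase_of_notMem h.1, ih h.2]

theorem erase_of_find {x : D} {m k : ℕ} {F : Forest D m} {p : List Bool} (hu : Uniq F.leaves)
    (h : F.find (some x) = some (k, p)) : F.erase x = F.set none k p := by
  induction F with
  | nil => simp [find] at h
  | @cons m t rest ih =>
    obtain ⟨h1, h2, h3⟩ := List.pairwise_append.1 hu
    rw [find] at h
    cases hf : t.find (some x) with
    | some q =>
      rw [hf] at h
      simp only [Option.some.injEq, Prod.mk.injEq] at h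
      obtain ⟨rfl, rfl⟩ := h
      have hn : some x ∉ rest.leaves := fun hm => by
        have hm' := t.get_mem_leaves (MTree.length_of_find hf)
        rw [MTree.get_of_find hf] at hm'
        simpa using h3 _ hm' _ hm rfl
      rw [erase, MTree.erase_of_find h1 hf, erase_of_notMem hn]
      simp [set]
    | none =>
      rw [hf] at h
      rw [erase, MTree.erase_of_notMem (MTree.find_eq_none.1 hf), ih h2 h, set,
        if_neg (of_find h).1.ne']

theorem fill_occs (x : D) {m : ℕ} (F : Forest D m) :
    (occFill m F.occs).val =
      (F.find none).map fun z => (z.1, z.2, (F.set (some x) z.1 z.2).occs) := by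
  induction F with
  | nil => rfl
  | @cons m t rest ih =>
    rw [occs, occFill, val_bind, t.fill_occ x, find]
    cases t.find none with
    | some q => simp [set, occs]
    | none =>
      cases hf : rest.find none with
      | none => simp [ih, hf]
      | some z => simp [ih, hf, set, occs, (of_find hf).1.ne']

/-- Each full tree costs two steps, and the search descends only in the first tree that is not full.
-/
theorem fill_occs_cost_le {m : ℕ} (F : Forest D m) : (occFill m F.occs).cost ≤ 2 * m := by
  induction F with
  | nil => simp [occFill]
  | @cons m t rest ih =>
    rw [occs, occFill, cost_bind]
    have h := t.isFull_occ
    have h1 := Occ.fill_cost_le m t.occ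
    cases hv : (t.occ.fill m).val with
    | some z => simp; omega
    | none =>
      have hf : t.find none = none := t.find_eq_none_of_fill hv
      rw [Occ.fill_cost_of_isFull m (h.2 hf)]
      simp
      omega

/-- The index formula counts only trees whose root is not `⊥`. Since the first vacant leaf lies in
the tree of depth `k`, all larger trees are full, in particular nonempty, and the formula counts all
of their leaves. -/
theorem vecOffset_roots_set (H : Option D → Option D → D) {m k : ℕ} {F : Forest D m}
    {p : List Bool} (h : F.find none = some (k, p)) (v : Option D) :
    (vecOffset k ((F.set v k p).roots H)).val.1 = treeOffset m k := by
  induction F with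
  | nil => simp [find] at h
  | @cons m t rest ih =>
    have hk := (of_find h).1
    by_cases hm : m = k
    · rw [treeOffset_of_le (by omega), vecOffset_of_le (by simp; omega)]
    · rw [find] at h
      cases hf : t.find none with
      | some q => rw [hf] at h; simp only [Option.some.injEq, Prod.mk.injEq] at h; exact absurd h.1 hm
      | none =>
        rw [hf] at h
        -- A root `⊥` would make all leaves `⊥`, whereas `t` has a leaf and none is vacant.
        have hs : (t.root H).isSome := by
          rw [Option.isSome_iff_ne_none, Ne, MTree.root_eq_none]
          intro ha
          refine MTree.find_eq_none.1 hf ?_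
          obtain ⟨y, hy⟩ := List.exists_mem_of_ne_nil _ t.leaves_ne_nil
          exact ha y hy ▸ hy
        rw [set, if_neg hm, roots, vecOffset_cons, length_roots, if_pos ⟨by omega, hs⟩, ih h,
          treeOffset_succ (by omega)]

/-- The new FID hangs at the end of the rightmost path, and no earlier leaf stores it. -/
theorem find_merge {x : D} {m : ℕ} {F : Forest D m} (h : some x ∉ F.leaves) :
    (F.merge x).find (some x) = some (List.replicate m true) := by
  induction F with
  | nil => simp [merge, MTree.find]
  | cons t rest ih =>
    simp only [leaves, List.mem_append, not_or] at h
    rw [merge, MTree.find, MTree.find_eq_none.2 h.1, ih h.2]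
    rfl

end Forest

/-! ### Lists of leaves without repeated FIDs -/

section

variable {D : Type}

theorem uniq_iff {xs : List (Option D)} :
    Uniq xs ↔ ∀ (i j : ℕ) (x : D), xs[i]? = some (some x) → xs[j]? = some (some x) → i = j := by
  rw [Uniq, List.pairwise_iff_getElem]
  constructor
  · intro h i j x hi hj
    obtain ⟨hi', hi⟩ := List.getElem?_eq_some_iff.1 hi
    obtain ⟨hj', hj⟩ := List.getElem?_eq_some_iff.1 hj
    by_contra hne
    rcases lt_or_gt_of_ne hne with hlt | hlt
    · have := h i j hi' hj' hlt (hi.trans hj.symm)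
      simp [hi] at this
    · have := h j i hj' hi' hlt (hj.trans hi.symm)
      simp [hj] at this
  · intro h i j hi hj hlt he
    by_contra hne
    obtain ⟨x, hx⟩ := Option.ne_none_iff_exists'.1 hne
    have := h i j x (by rw [List.getElem?_eq_getElem hi, hx])
      (by rw [List.getElem?_eq_getElem hj, ← he, hx])
    omega

theorem Uniq.set_none {xs : List (Option D)} (h : Uniq xs) (i : ℕ) : Uniq (xs.set i none) := by
  rw [uniq_iff] at h ⊢
  intro a b x ha hb
  rw [List.getElem?_set] at ha hb
  split_ifs at ha hb <;> first | exact h a b x ha hb | simp_all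

theorem Uniq.set_some {xs : List (Option D)} (h : Uniq xs) {x : D} (hx : some x ∉ xs) (i : ℕ) :
    Uniq (xs.set i (some x)) := by
  rw [uniq_iff] at h ⊢
  intro a b y ha hb
  have hn : ∀ j : ℕ, xs[j]? ≠ some (some x) := fun j hj => hx (List.mem_of_getElem? hj)
  rw [List.getElem?_set] at ha hb
  split_ifs at ha hb <;>
    first
    | exact h a b y ha hb
    | omega
    | simp_all

theorem uniq_replicate_none (n : ℕ) : Uniq (List.replicate n (none : Option D)) := by
  simp [Uniq, List.pairwise_replicate]

theorem Uniq.append_new {xs : List (Option D)} (h : Uniq xs) {x : D} (hx : some x ∉ xs) (n : ℕ) :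
    Uniq (xs ++ [some x] ++ List.replicate n none) := by
  refine List.pairwise_append.2 ⟨List.pairwise_append.2 ⟨h, by simp, ?_⟩,
    uniq_replicate_none n, ?_⟩
  · rintro a ha b hb rfl
    simp only [List.mem_singleton] at hb
    exact absurd (hb ▸ ha) hx
  · rintro a - b hb rfl
    exact List.eq_of_mem_replicate hb

theorem Uniq.idxOf?_eq_some [DecidableEq D] {xs : List (Option D)} (h : Uniq xs) {x : D} {i : ℕ} :
    xs.idxOf? (some x) = some i ↔ xs[i]? = some (some x) := by
  have key : ∀ j, xs.idxOf? (some x) = some j → xs[j]? = some (some x) := by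
    intro j hj
    rw [List.idxOf?, List.findIdx?_eq_some_iff_getElem] at hj
    obtain ⟨hl, hb, -⟩ := hj
    rw [List.getElem?_eq_getElem hl, eq_of_beq hb]
  refine ⟨key i, fun hi => ?_⟩
  cases hj : xs.idxOf? (some x) with
  | none => exact absurd (List.mem_of_getElem? hi) (List.idxOf?_eq_none_iff.1 hj)
  | some j => rw [uniq_iff.1 h _ _ _ (key j hj) hi]

theorem length_rootPath (H : Option D → Option D → D) {m : ℕ} (F : Forest D m) :
    (((F.roots H).map fun r => (r, true)).reverse).length = m := by
  simp

/-- Merging hangs the old trees to the left of the rightmost path, so the old roots, smallest tree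
first, are its siblings. -/
theorem recompute_merge (H : Option D → Option D → D) {m : ℕ} (F : Forest D m) (x : D) :
    (recompute H ((F.roots H).map fun r => (r, true)).reverse (some x)).val =
      (F.merge x).root H := by
  have h := (F.merge x).set_get (List.replicate m true)
  rw [Forest.get_merge] at h
  rw [← Forest.path_merge H x, MTree.recompute_path _ _ (by simp), h]

theorem stored_eq_countP (st : ACA D) : st.stored = st.forest.leaves.countP Option.isSome :=
  List.countP_eq_length_filter.symm

variable [DecidableEq D]

/-! ## States of the accumulator -/

namespace ACA

theorem mapping_eq (st : ACA D) (x : D) : st.mapping x =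
    (st.forest.find (some x)).map fun z => treeOffset st.m z.1 + pathPos z.2 + 1 := by
  rw [mapping, ← Forest.find_pos, Option.map_map]
  rfl

theorem mapping_eq_none {st : ACA D} {x : D} :
    st.mapping x = none ↔ some x ∉ st.forest.leaves := by
  rw [mapping_eq, Option.map_eq_none_iff, Forest.find_eq_none]

theorem mapping_eq_some {st : ACA D} (h : Uniq st.forest.leaves) {x : D} {i : ℕ} :
    st.mapping x = some i ↔ 1 ≤ i ∧ st.forest.leaves[i - 1]? = some (some x) := by
  rw [mapping, Option.map_eq_some_iff, ← h.idxOf?_eq_some]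
  constructor
  · rintro ⟨j, hj, rfl⟩
    exact ⟨by omega, by simpa using hj⟩
  · rintro ⟨h1, h2⟩
    exact ⟨i - 1, h2, by omega⟩

theorem insert_of_find {st : ACA D} {x : D} {k : ℕ} {p : List Bool}
    (h : st.forest.find none = some (k, p)) : st.insert x = ⟨st.m, st.forest.set (some x) k p⟩ := by
  rw [insert, Forest.insert_eq, h]
  rfl

theorem insert_of_full {st : ACA D} {x : D} (h : st.forest.find none = none) :
    st.insert x = ⟨st.m + 1, Forest.cons (st.forest.merge x) (Forest.empty st.m)⟩ := by
  rw [insert, Forest.insert_eq, h]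
  rfl

theorem delete_of_find {st : ACA D} (hu : Uniq st.forest.leaves) {x : D} {k : ℕ} {p : List Bool}
    (h : st.forest.find (some x) = some (k, p)) :
    st.delete x = ⟨st.m, st.forest.set none k p⟩ := by
  rw [delete, Forest.erase_of_find hu h]

theorem leaves_insert_of_full {st : ACA D} {x : D} (h : st.forest.find none = none) :
    (st.insert x).forest.leaves =
      st.forest.leaves ++ [some x] ++ List.replicate (2 ^ st.m - 1) none := by
  rw [insert_of_full h, Forest.leaves, Forest.leaves_merge, Forest.leaves_empty]

theorem uniq_insert {st : ACA D} (hu : Uniq st.forest.leaves) {x : D}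
    (hx : some x ∉ st.forest.leaves) : Uniq (st.insert x).forest.leaves := by
  cases h : st.forest.find none with
  | none => rw [leaves_insert_of_full h]; exact hu.append_new hx _
  | some z =>
    obtain ⟨h1, h2, -⟩ := Forest.of_find h
    rw [insert_of_find h, Forest.leaves_set _ h1 h2]
    exact hu.set_some hx _

theorem find_insert_of_find {st : ACA D} (hu : Uniq st.forest.leaves) {x : D}
    (hx : some x ∉ st.forest.leaves) {k : ℕ} {p : List Bool}
    (h : st.forest.find none = some (k, p)) :
    (st.forest.set (some x) k p).find (some x) = some (k, p) := by
  obtain ⟨h1, h2, -⟩ := Forest.of_find h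
  have hu' := uniq_insert hu hx
  rw [insert_of_find h] at hu'
  exact Forest.find_of_get hu' h1 h2 (Forest.get_set _ h1 h2 _)

end ACA

theorem Valid.tail {r : Request D} {reqs : List (Request D)} (h : Valid (r :: reqs)) :
    Valid reqs := by
  cases r <;> exact h.2

theorem Valid.exists_find {x : D} {reqs : List (Request D)} (h : Valid (Request.delete x :: reqs)) :
    ∃ k p, (state reqs).forest.find (some x) = some (k, p) := by
  obtain ⟨⟨k, p⟩, h⟩ := Option.ne_none_iff_exists'.1 fun hn : (state reqs).forest.find (some x) = none =>
    h.1 (by rw [ACA.mapping_eq, hn]; rfl)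
  exact ⟨k, p, h⟩

theorem Valid.notMem {x : D} {reqs : List (Request D)} (h : Valid (Request.upload x :: reqs)) :
    some x ∉ (state reqs).forest.leaves :=
  ACA.mapping_eq_none.1 h.1

theorem uniq_state {reqs : List (Request D)} (h : Valid reqs) :
    Uniq (state reqs).forest.leaves := by
  induction reqs with
  | nil => exact uniq_replicate_none 1
  | cons r reqs ih =>
    have hu := ih h.tail
    cases r with
    | upload x => exact ACA.uniq_insert hu h.notMem
    | delete x =>
      obtain ⟨k, p, hf⟩ := h.exists_find
      obtain ⟨h1, h2, -⟩ := Forest.of_find hf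
      rw [state, ACA.delete_of_find hu hf, Forest.leaves_set _ h1 h2]
      exact hu.set_none _

/-! ## The records that the protocol prescribes -/

variable {File : Type} (S : HashSuite D File)

/-- An honest miner reads everything off the new state; this form refers to the old state only,
which is what a verifier's checks are about. The next two lemmas do the same for merges and
deletions. -/
theorem makeUpload_of_find {st : ACA D} (hu : Uniq st.forest.leaves) {x : D}
    (hx : some x ∉ st.forest.leaves) {k : ℕ} {p : List Bool}
    (h : st.forest.find none = some (k, p)) (prev : D) :
    makeUpload S st x prev =
      { vec := replaceEntry k (recompute S.node (st.forest.path S.node k p) (some x)).val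
          (st.forest.roots S.node)
        root := (recompute S.node (st.forest.path S.node k p) (some x)).val
        wit := st.forest.path S.node k p
        fid := x
        index := 1 + treeOffset st.m k + pathPos p
        prev := prev } := by
  obtain ⟨h1, h2, -⟩ := Forest.of_find h
  have hv := Forest.vecOffset_roots_set S.node h (some x)
  rw [Forest.roots_set _ _ h2] at hv
  unfold makeUpload
  rw [ACA.insert_of_find h]
  simp only [Forest.witness_eq, ACA.find_insert_of_find hu hx h, Option.map_some, Option.getD_some, Forest.path_set,
    Forest.roots_set _ _ h2, assignIndex_val, Forest.length_path _ _ h1 h2,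
    Forest.pathOffset_path _ _ h1 h2, hv]
  rw [entry_replaceEntry _ (by simpa using h1), Option.getD_some]

theorem makeUpload_of_full {st : ACA D} {x : D} (hx : some x ∉ st.forest.leaves)
    (h : st.forest.find none = none) (prev : D) :
    makeUpload S st x prev =
      { vec := (st.forest.merge x).root S.node :: List.replicate st.m none
        root := (st.forest.merge x).root S.node
        wit := ((st.forest.roots S.node).map fun r => (r, true)).reverse
        fid := x
        index := 1 + pathPos (List.replicate st.m true)
        prev := prev } := by
  have hp := (st.forest.merge x).pathOffset_path S.node (p := List.replicate st.m true) (by simp)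
  rw [Forest.path_merge] at hp
  unfold makeUpload
  rw [ACA.insert_of_full h]
  simp only [Forest.witness_eq, Forest.find,
    Forest.find_merge hx, Option.map_some, Option.getD_some, Forest.path, if_true,
    Forest.path_merge, Forest.roots, Forest.roots_empty, assignIndex_val, length_rootPath, hp]
  rw [vecOffset_of_le (by simp), entry_cons, if_pos (by simp), Option.getD_some, add_zero]

theorem makeDelete_of_find {st : ACA D} (hu : Uniq st.forest.leaves) {x : D} {k : ℕ}
    {p : List Bool} (h : st.forest.find (some x) = some (k, p)) (prev : D) :
    makeDelete S st x prev =
      { vec := replaceEntry k (recompute S.node (st.forest.path S.node k p) none).val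
          (st.forest.roots S.node)
        root := (recompute S.node (st.forest.path S.node k p) none).val
        wit := st.forest.path S.node k p
        fid := x
        prev := prev } := by
  obtain ⟨h1, h2, -⟩ := Forest.of_find h
  unfold makeDelete
  rw [ACA.delete_of_find hu h]
  simp only [Forest.witness_eq, h, Option.map_some,
    Option.getD_some, Forest.roots_set _ _ h2, Forest.length_path _ _ h1 h2]
  rw [entry_replaceEntry _ (by simpa using h1), Option.getD_some]

/-! ## Verification against a correct ledger -/

/-- The ledger of a verifier whose latest recorded state is `st`. -/
def ledgerOf (st : ACA D) (head : D) : Ledger D :=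
  ⟨st.forest.roots S.node, st.forest.occs, head⟩

/-- The timed program is flattened to the conjunction of its checks. The branch is chosen by the
ledger alone, hence the separate statement for a full forest. -/
theorem verifyUpload_of_fill {L : Ledger D} {k : ℕ} {p : List Bool} {os : List Occ}
    (h : (occFill L.vec.length L.occ).val = some (k, p, os)) (x : D) (q : UploadProof D)
    (L' : Ledger D) :
    (verifyUpload S L x q).val = some L' ↔
      q.fid = x ∧ q.prev = L.head ∧ q.wit.length ≤ L.vec.length ∧
      q.vec.length ≤ L.vec.length + 1 ∧
      (entry q.wit.length q.vec).val.1 = some q.root ∧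
      (recompute S.node q.wit (some x)).val = q.root ∧
      (assignIndex q.vec q.wit).val = q.index ∧
      k = q.wit.length ∧ (q.wit.map Prod.snd).reverse = p ∧
      (entry q.wit.length L.vec).val.1 = some (recompute S.node q.wit none).val ∧
      (agreeOff q.wit.length q.vec L.vec).val.1 = true ∧
      L' = ⟨q.vec, os, S.record (Record.upload q)⟩ := by
  simp only [verifyUpload, val_bind, check_val_eq_some, size_val, atMost_val, h, directions_val,
    eqList_val, val_pure, Bool.and_eq_true, decide_eq_true_eq, List.length_cons,
    Option.some.injEq, and_assoc, eq_comm (b := L')]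

theorem verifyUpload_of_full {L : Ledger D} (h : (occFill L.vec.length L.occ).val = none) (x : D)
    (q : UploadProof D) (L' : Ledger D) :
    (verifyUpload S L x q).val = some L' ↔
      q.fid = x ∧ q.prev = L.head ∧ q.wit.length ≤ L.vec.length ∧
      q.vec.length ≤ L.vec.length + 1 ∧
      (entry q.wit.length q.vec).val.1 = some q.root ∧
      (recompute S.node q.wit (some x)).val = q.root ∧
      (assignIndex q.vec q.wit).val = q.index ∧
      q.vec = q.root :: List.replicate L.vec.length none ∧
      q.wit = (L.vec.map fun r => (r, true)).reverse ∧
      L' = ⟨q.vec, Occ.full :: List.replicate L.vec.length Occ.empty,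
        S.record (Record.upload q)⟩ := by
  simp only [verifyUpload, val_bind, check_val_eq_some, size_val, atMost_val, h, mapList_val,
    revList_val, eqList_val, val_pure, Bool.and_eq_true, decide_eq_true_eq, List.length_cons,
    Option.some.injEq, and_assoc, eq_comm (b := L'), List.map_const']

theorem verifyDelete_iff (L : Ledger D) (x : D) (q : DeleteProof D) (L' : Ledger D) :
    (verifyDelete S L x q).val = some L' ↔
      q.fid = x ∧ q.prev = L.head ∧ q.wit.length ≤ L.vec.length ∧ q.vec.length ≤ L.vec.length ∧
      (entry q.wit.length L.vec).val.1 = some (recompute S.node q.wit (some x)).val ∧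
      (agreeOff q.wit.length q.vec L.vec).val.1 = true ∧
      (entry q.wit.length q.vec).val.1 = some q.root ∧
      (if q.root.isSome then (recompute S.node q.wit none).val = q.root
        else ∀ e ∈ q.wit, e.1 = none) ∧
      L' = ⟨q.vec, (occClear q.wit.length (q.wit.map Prod.snd).reverse L.occ).val.1,
        S.record (Record.delete q)⟩ := by
  cases hr : q.root.isSome <;>
  simp [verifyDelete, val_bind, check_val_eq_some, size_val, atMost_val, directions_val, val_pure,
    Bool.and_eq_true, decide_eq_true_eq, Option.some.injEq, and_assoc, eq_comm (b := L'), hr,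
    allEmpty_val]

end

section

variable {D : Type} [DecidableEq D] {File : Type} (S : HashSuite D File)

theorem entry_ledgerOf {st : ACA D} {k : ℕ} {p : List Bool} {y : Option D}
    (h : st.forest.find y = some (k, p)) :
    (entry k (st.forest.roots S.node)).val.1 =
      some (recompute S.node (st.forest.path S.node k p) y).val := by
  obtain ⟨h1, h2, h3⟩ := Forest.of_find h
  rw [Forest.entry_roots S.node _ h1 h2, h3]

theorem fill_ledgerOf (st : ACA D) (head x : D) :
    (occFill (ledgerOf S st head).vec.length (ledgerOf S st head).occ).val =
      (st.forest.find none).map fun z => (z.1, z.2, (st.forest.set (some x) z.1 z.2).occs) := by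
  simp only [ledgerOf, Forest.length_roots, Forest.fill_occs x]

theorem verifyUpload_makeUpload {st : ACA D} (hu : Uniq st.forest.leaves) {x : D}
    (hx : some x ∉ st.forest.leaves) (head : D) :
    (verifyUpload S (ledgerOf S st head) x (makeUpload S st x head)).val =
      some (ledgerOf S (st.insert x) (S.record (Record.upload (makeUpload S st x head)))) := by
  have hf := fill_ledgerOf S st head x
  cases h : st.forest.find none with
  | none =>
    rw [h] at hf
    rw [verifyUpload_of_full S hf]
    have hi := ACA.insert_of_full (x := x) h
    rw [hi]
    rw [makeUpload_of_full S hx h]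
    have hp := (st.forest.merge x).pathOffset_path S.node (p := List.replicate st.m true) (by simp)
    rw [Forest.path_merge] at hp
    refine ⟨rfl, rfl, by simp [ledgerOf], by simp [ledgerOf], by simp [entry_cons],
      recompute_merge _ _ _, ?_, by simp [ledgerOf], rfl, ?_⟩
    · rw [assignIndex_val, vecOffset_of_le (by simp), hp, add_zero]
    -- The verifier records the new tree as full without looking; this is right because a merge
    -- happens only when no leaf was vacant.
    · have hfull : (st.forest.merge x).occ = Occ.full :=
        Occ.eq_full ((MTree.isFull_occ _).2 (MTree.find_eq_none.2 (by
          rw [Forest.leaves_merge]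
          simpa using Forest.find_eq_none.1 h)))
      simp only [ledgerOf, Forest.roots, Forest.roots_empty, Forest.occs, Forest.occs_empty, hfull,
        Forest.length_roots]
  | some z =>
    obtain ⟨k, p⟩ := z
    obtain ⟨h1, h2, -⟩ := Forest.of_find h
    rw [h] at hf
    rw [verifyUpload_of_fill S hf, ACA.insert_of_find h, makeUpload_of_find S hu hx h]
    have hl := st.forest.length_path S.node h1 h2
    have hv := Forest.vecOffset_roots_set S.node h (some x)
    rw [Forest.roots_set _ _ h2] at hv
    simp only [hl, assignIndex_val, Forest.pathOffset_path _ _ h1 h2,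
      Forest.directions_path _ _ h1 h2, hv, agreeOff_replaceEntry, ledgerOf, Forest.length_roots,
      length_replaceEntry, entry_ledgerOf S h, Forest.roots_set _ _ h2, true_and, and_true]
    exact ⟨by omega, by omega, entry_replaceEntry _ (by simpa using h1)⟩

theorem verifyDelete_makeDelete {st : ACA D} (hu : Uniq st.forest.leaves) {x : D} {k : ℕ}
    {p : List Bool} (h : st.forest.find (some x) = some (k, p)) (head : D) :
    (verifyDelete S (ledgerOf S st head) x (makeDelete S st x head)).val =
      some (ledgerOf S (st.delete x) (S.record (Record.delete (makeDelete S st x head)))) := by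
  obtain ⟨h1, h2, -⟩ := Forest.of_find h
  rw [verifyDelete_iff, ACA.delete_of_find hu h, makeDelete_of_find S hu h]
  have hl := st.forest.length_path S.node h1 h2
  simp only [hl, Forest.directions_path _ _ h1 h2, agreeOff_replaceEntry, ledgerOf,
    Forest.length_roots, length_replaceEntry, entry_ledgerOf S h, Forest.roots_set _ _ h2,
    Forest.clear_occs _ h2, true_and, and_true, le_refl]
  refine ⟨by omega, entry_replaceEntry _ (by simpa using h1), ?_⟩
  split_ifs with hs
  -- If the new root is `⊥`, the verifier inspects the siblings; a recomputed `⊥` forces them all to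
  -- be `⊥`.
  · exact (allEmpty_of_recompute S.node (by simpa using hs)).2

/-! ### Completeness and soundness for whole logs -/

theorem replay_honestLog {reqs : List (Request D)} (h : Valid reqs) :
    replay S (honestLog S reqs) =
      some (ledgerOf S (state reqs) (headHash S (honestLog S reqs))) := by
  induction reqs with
  | nil => rfl
  | cons r reqs ih =>
    have hu := uniq_state h.tail
    cases r with
    | upload x =>
      rw [honestLog, replay, ih h.tail]
      exact verifyUpload_makeUpload S hu h.notMem _
    | delete x =>
      obtain ⟨k, p, hf⟩ := h.exists_find
      rw [honestLog, replay, ih h.tail]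
      exact verifyDelete_makeDelete S hu hf _

/-- Without a collision, the only accepted upload proof is the prescribed one. -/
theorem eq_makeUpload {st : ACA D} (hu : Uniq st.forest.leaves) {x : D}
    (hx : some x ∉ st.forest.leaves) {head : D} {q : UploadProof D} {L : Ledger D}
    (h : (verifyUpload S (ledgerOf S st head) x q).val = some L)
    (hc : ¬ CollisionIn S.node (st.forest.hashInputs S.node ++ pathInputs S.node q.wit none)) :
    q = makeUpload S st x head := by
  have hf := fill_ledgerOf S st head x
  cases hn : st.forest.find none with
  | none =>
    rw [hn] at hf
    rw [verifyUpload_of_full S hf] at h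
    -- A merge needs no collision argument: the checks prescribe the witness, and root, vector and
    -- index follow from it.
    obtain ⟨h1, h2, -, -, -, h6, h7, h8, h9, -⟩ := h
    rw [makeUpload_of_full S hx hn]
    have hp := (st.forest.merge x).pathOffset_path S.node (p := List.replicate st.m true) (by simp)
    rw [Forest.path_merge] at hp
    obtain ⟨vec, root, wit, fid, index, prev⟩ := q
    simp only [ledgerOf, Forest.length_roots] at h1 h2 h6 h7 h8 h9
    subst h1 h2 h9
    rw [recompute_merge] at h6
    subst h6 h8
    rw [assignIndex_val, vecOffset_of_le (by simp), hp, add_zero] at h7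
    rw [h7]
  | some z =>
    obtain ⟨k, p⟩ := z
    obtain ⟨hk, hp, -⟩ := Forest.of_find hn
    rw [hn] at hf
    rw [verifyUpload_of_fill S hf] at h
    obtain ⟨h1, h2, -, -, h5, h6, h7, h8, h9, h10, h11, -⟩ := h
    have hv := Forest.vecOffset_roots_set S.node hn (some x)
    rw [Forest.roots_set _ _ hp] at hv
    rw [makeUpload_of_find S hu hx hn]
    -- The witness is compared with the old tree, where the leaf to be filled still contains `⊥`;
    -- its position comes from the occupancy.
    obtain ⟨hw, -⟩ := st.forest.path_of_recompute h10 hc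
    rw [h9, ← h8] at hw
    obtain ⟨vec, root, wit, fid, index, prev⟩ := q
    simp only [ledgerOf] at h1 h2 h5 h6 h7 h8 h9 h11 hw
    have hvec := eq_replaceEntry_of_agreeOff h11 h5
    rw [assignIndex_val, hvec] at h7
    rw [← h8, hw, ← h6, hw, hv, Forest.pathOffset_path _ _ hk hp] at h7
    rw [← h8, ← h6, hw] at hvec
    rw [hw] at h6
    rw [hvec, ← h6, hw, h1, ← h7, h2]

/-- Without a collision, the only accepted deletion proof is the prescribed one. -/
theorem eq_makeDelete {st : ACA D} (hu : Uniq st.forest.leaves) {x head : D} {q : DeleteProof D}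
    {L : Ledger D} (h : (verifyDelete S (ledgerOf S st head) x q).val = some L)
    (hc : ¬ CollisionIn S.node (st.forest.hashInputs S.node ++ pathInputs S.node q.wit (some x))) :
    q = makeDelete S st x head := by
  rw [verifyDelete_iff] at h
  obtain ⟨h1, h2, -, -, h5, h6, h7, h8, -⟩ := h
  obtain ⟨hw, hg⟩ := st.forest.path_of_recompute h5 hc
  have hk := lt_of_entry_eq_some h5
  simp only [ledgerOf, Forest.length_roots] at hk
  have hfind := Forest.find_of_get hu hk (by simp) hg
  rw [makeDelete_of_find S hu hfind]
  -- Both alternatives of the check amount to this: if the shown root is `⊥`, all siblings are `⊥`,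
  -- so the recomputed root is `⊥` too.
  have hroot : q.root = (recompute S.node q.wit none).val := by
    split_ifs at h8 with hs
    · exact h8.symm
    · rw [recompute_none_of_allEmpty S.node h8]
      simpa using hs
  have hvec := eq_replaceEntry_of_agreeOff h6 h7
  rw [hroot] at hvec
  rw [← hw]
  obtain ⟨vec, root, wit, fid, prev⟩ := q
  simp only [ledgerOf] at h1 h2 hroot hvec
  rw [hvec, hroot, h1, h2]

theorem honestLog_or_collision {log : Log D} (hv : Valid (log.map Prod.fst))
    (h : (replay S log).isSome) :
    log = honestLog S (log.map Prod.fst) ∨ CollisionIn S.node (logInputs S.node log) := by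
  induction log with
  | nil => exact Or.inl rfl
  | cons e log ih =>
    by_cases hc : CollisionIn S.node (logInputs S.node (e :: log))
    · exact Or.inr hc
    left
    obtain ⟨L, hL⟩ := Option.isSome_iff_exists.1 h
    rw [replay, Option.bind_eq_some_iff] at hL
    obtain ⟨L₀, hL₀, hver⟩ := hL
    have hlog := (ih hv.tail (by simp [hL₀])).resolve_right fun hc' => hc (hc'.mono (by
      intro z; simp only [logInputs, List.mem_append]; tauto))
    -- As the earlier records are the prescribed ones, the newest was checked against the ledger of
    -- the true state.
    rw [hlog, replay_honestLog S hv.tail, Option.some.injEq] at hL₀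
    subst hL₀
    have hu := uniq_state hv.tail
    obtain ⟨r, q⟩ := e
    rw [List.map_cons]
    cases r with
    | upload x =>
      cases q with
      | delete q => simp [verify] at hver
      | upload q =>
        have hq := eq_makeUpload S hu (Valid.notMem hv) hver fun hc' => hc (hc'.mono (by
          intro z; simp only [logInputs, recordInputs, List.mem_append]; tauto))
        rw [honestLog, ← hq, ← hlog]
    | delete x =>
      cases q with
      | upload q => simp [verify] at hver
      | delete q =>
        -- The listed inputs start from the FID in the record, the soundness lemma from the
        -- requested one.
        have hx : q.fid = x := ((verifyDelete_iff S _ _ _ _).1 hver).1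
        have hq := eq_makeDelete S hu hver fun hc' => hc (hc'.mono (by
          rw [← hx]
          intro z; simp only [logInputs, recordInputs, List.mem_append]; tauto))
        rw [honestLog, ← hq, ← hlog]

/-! ## Bounds on the size of the forest -/

theorem stored_insert_of_full {st : ACA D} (h : st.forest.find none = none) (x : D) :
    (st.insert x).stored = 2 ^ st.m := by
  have hl := st.forest.length_leaves
  have hc : st.forest.leaves.countP Option.isSome = st.forest.leaves.length := by
    rw [List.countP_eq_length]
    intro a ha
    rw [Option.isSome_iff_ne_none]
    rintro rfl
    exact Forest.find_eq_none.1 h ha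
  rw [stored_eq_countP, ACA.leaves_insert_of_full h]
  simp [List.countP_append, hc, List.countP_replicate, hl]

theorem stored_insert_le (st : ACA D) (x : D) : (st.insert x).stored ≤ st.stored + 1 := by
  cases h : st.forest.find none with
  | none =>
    rw [stored_eq_countP, stored_eq_countP, ACA.leaves_insert_of_full h]
    simp [List.countP_append, List.countP_replicate]
  | some z =>
    obtain ⟨h1, h2, -⟩ := Forest.of_find h
    rw [stored_eq_countP, stored_eq_countP, ACA.insert_of_find h, Forest.leaves_set _ h1 h2,
      List.countP_set]
    · simp
    · have := st.forest.length_leaves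
      have := Forest.pos_lt h1 h2
      omega

theorem stored_delete_le {st : ACA D} (hu : Uniq st.forest.leaves) {x : D} {k : ℕ}
    {p : List Bool} (h : st.forest.find (some x) = some (k, p)) :
    (st.delete x).stored ≤ st.stored := by
  obtain ⟨h1, h2, -⟩ := Forest.of_find h
  rw [stored_eq_countP, stored_eq_countP, ACA.delete_of_find hu h, Forest.leaves_set _ h1 h2,
    List.countP_set]
  · simp
  · have := st.forest.length_leaves
    have := Forest.pos_lt h1 h2
    omega

theorem stored_le_length {reqs : List (Request D)} (h : Valid reqs) :
    (state reqs).stored ≤ reqs.length := by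
  induction reqs with
  | nil => exact le_rfl
  | cons r reqs ih =>
    have hi := ih h.tail
    cases r with
    | upload x => exact (stored_insert_le _ x).trans (by simpa using hi)
    | delete x =>
      obtain ⟨k, p, hf⟩ := h.exists_find
      exact (stored_delete_le (uniq_state h.tail) hf).trans (hi.trans (by simp))

theorem peak_le_length {reqs : List (Request D)} (h : Valid reqs) : peak reqs ≤ reqs.length := by
  induction reqs with
  | nil => exact le_rfl
  | cons r reqs ih =>
    exact max_le (stored_le_length h) ((ih h.tail).trans (by simp))

/-- The length of the vector increases only when every leaf is occupied, and then `2 ^ m` files are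
stored for the old `m` (`stored_insert_of_full`). Afterwards `m` never decreases, but neither does
the peak. The maximum with `1` covers the initial vector of length `1`. -/
theorem two_pow_le_peak {reqs : List (Request D)} (h : Valid reqs) :
    2 ^ (state reqs).m ≤ 2 * max 1 (peak reqs) := by
  induction reqs with
  | nil => simp [state, ACA.gen]
  | cons r reqs ih =>
    have hi := ih h.tail
    have hp : max 1 (peak reqs) ≤ max 1 (peak (r :: reqs)) := max_le_max le_rfl (le_max_right _ _)
    cases r with
    | upload x =>
      cases hf : (state reqs).forest.find none with
      | none =>
        have hs := stored_insert_of_full hf x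
        have hm : (state (Request.upload x :: reqs)).m = (state reqs).m + 1 := by
          rw [state, ACA.insert_of_full hf]
        rw [hm, pow_succ, mul_comm, ← hs]
        exact Nat.mul_le_mul_left 2 (le_max_of_le_right (le_max_left _ _))
      | some z =>
        have hm : (state (Request.upload x :: reqs)).m = (state reqs).m := by
          rw [state, ACA.insert_of_find (k := z.1) (p := z.2) hf]
        rw [hm]
        omega
    | delete x =>
      have hm : (state (Request.delete x :: reqs)).m = (state reqs).m := rfl
      rw [hm]
      omega

theorem verify_lengths {L L' : Ledger D} {r : Request D} {q : Record D}
    (h : (verify S L r q).val = some L') :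
    L'.vec.length ≤ L.vec.length + 1 ∧ (recordInputs S.node q).length ≤ 2 * L.vec.length := by
  cases r with
  | upload x =>
    cases q with
    | delete q => simp [verify] at h
    | upload q =>
      rw [verify] at h
      have hw : q.wit.length ≤ L.vec.length ∧ q.vec.length ≤ L.vec.length + 1 ∧
          L'.vec = q.vec := by
        cases hf : (occFill L.vec.length L.occ).val with
        | none =>
          rw [verifyUpload_of_full S hf] at h
          obtain ⟨-, -, h3, h4, -, -, -, -, -, h5⟩ := h
          exact ⟨h3, h4, by rw [h5]⟩
        | some z =>
          rw [verifyUpload_of_fill S (k := z.1) (p := z.2.1) (os := z.2.2) hf] at h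
          obtain ⟨-, -, h3, h4, -, -, -, -, -, -, -, h5⟩ := h
          exact ⟨h3, h4, by rw [h5]⟩
      rw [hw.2.2]
      simp [recordInputs]
      omega
  | delete x =>
    cases q with
    | upload q => simp [verify] at h
    | delete q =>
      rw [verify, verifyDelete_iff] at h
      obtain ⟨-, -, h3, h4, -, -, -, -, h5⟩ := h
      rw [h5]
      simp [recordInputs]
      omega

theorem length_vec_le {log : Log D} {L : Ledger D} (h : replay S log = some L) :
    L.vec.length ≤ log.length + 1 := by
  induction log generalizing L with
  | nil => simp only [replay, Option.some.injEq] at h; simp [← h, genesisLedger]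
  | cons e log ih =>
    rw [replay, Option.bind_eq_some_iff] at h
    obtain ⟨L₀, hL₀, hver⟩ := h
    have := ih hL₀
    have := (verify_lengths S hver).1
    simp
    omega

theorem length_logInputs_le {log : Log D} (hv : Valid (log.map Prod.fst))
    (h : (replay S log).isSome) :
    (logInputs S.node log).length ≤ 4 * (log.length + 1) ^ 2 := by
  induction log with
  | nil => simp [logInputs]
  | cons e log ih =>
    obtain ⟨L, hL⟩ := Option.isSome_iff_exists.1 h
    rw [replay, Option.bind_eq_some_iff] at hL
    obtain ⟨L₀, hL₀, hver⟩ := hL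
    have h1 := ih hv.tail (by simp [hL₀])
    have h2 := length_vec_le S hL₀
    have h3 := (verify_lengths S hver).2
    have h4 := (state (log.map Prod.fst)).forest.length_hashInputs_le S.node
    have h5 := two_pow_le_peak hv.tail
    have h6 := peak_le_length hv.tail
    rw [List.length_map] at h6
    -- With `T` earlier records, the new record contributes fewer than `2 (T + 1)` inputs from the
    -- forest and at most `2 (T + 1)` from its two recomputations; this is less than the increase of
    -- `4 (T + 1) ^ 2`.
    have h7 : max 1 (peak (log.map Prod.fst)) ≤ log.length + 1 := by omega
    simp only [logInputs, List.length_append, List.length_cons]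
    nlinarith

end

section

variable {D : Type} [DecidableEq D]

/-! ## The mapping from FIDs to indices -/

namespace ACA

theorem mapping_congr {st st' : ACA D} (hu : Uniq st.forest.leaves) (hu' : Uniq st'.forest.leaves)
    {y : D}
    (h : ∀ i : ℕ, st'.forest.leaves[i]? = some (some y) ↔ st.forest.leaves[i]? = some (some y)) :
    st'.mapping y = st.mapping y := by
  refine congrArg (Option.map (· + 1)) (Option.ext fun i => ?_)
  rw [hu.idxOf?_eq_some, hu'.idxOf?_eq_some, h]

theorem mapping_ne_some_iff {st : ACA D} (hu : Uniq st.forest.leaves) {j : ℕ} (hj : 1 ≤ j) :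
    (∀ y, st.mapping y ≠ some j) ↔ ∀ y, st.forest.leaves[j - 1]? ≠ some (some y) := by
  refine forall_congr' fun y => not_congr ?_
  rw [mapping_eq_some hu]
  exact and_iff_right hj

/-- Storing a new FID in the first vacant leaf, or behind all leaves if there is none. -/
theorem mapping_of_store {st st' : ACA D} (hu : Uniq st.forest.leaves)
    (hu' : Uniq st'.forest.leaves) {x : D} {j : ℕ}
    (hj : ∀ y, st.forest.leaves[j]? ≠ some (some y))
    (hlt : ∀ i < j, ∃ y, st.forest.leaves[i]? = some (some y))
    (hnew : st'.forest.leaves[j]? = some (some x))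
    (hold : ∀ i ≠ j, ∀ y,
      st'.forest.leaves[i]? = some (some y) ↔ st.forest.leaves[i]? = some (some y)) :
    IsLeast {j : ℕ | 1 ≤ j ∧ ∀ y, st.mapping y ≠ some j} (j + 1) ∧
      st'.mapping = Function.update st.mapping x (some (j + 1)) := by
  refine ⟨⟨⟨by omega, (mapping_ne_some_iff hu (by omega)).2 hj⟩, ?_⟩, ?_⟩
  · rintro i ⟨hi, hn⟩
    rw [mapping_ne_some_iff hu hi] at hn
    by_contra hlt'
    obtain ⟨y, hy⟩ := hlt (i - 1) (by omega)
    exact hn y hy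
  · funext y
    by_cases hy : y = x
    · subst hy
      rw [Function.update_self, mapping_eq_some hu']
      exact ⟨by omega, hnew⟩
    · rw [Function.update_of_ne hy]
      refine mapping_congr hu hu' fun i => ?_
      by_cases hi : i = j
      · subst hi
        simp only [hnew, Option.some.injEq, hj y, iff_false]
        exact Ne.symm hy
      · exact hold i hi y

theorem mapping_insert {st : ACA D} (hu : Uniq st.forest.leaves) {x : D}
    (hx : some x ∉ st.forest.leaves) :
    ∃ i, IsLeast {j : ℕ | 1 ≤ j ∧ ∀ y, st.mapping y ≠ some j} i ∧
      (st.insert x).mapping = Function.update st.mapping x (some i) := by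
  have hu' := uniq_insert hu hx
  cases h : st.forest.find none with
  | none =>
    have hl := leaves_insert_of_full (x := x) h
    refine ⟨_, mapping_of_store (j := st.forest.leaves.length) hu hu' (by simp) ?_ ?_ ?_⟩
    · intro i hi
      rw [List.getElem?_eq_getElem hi]
      cases hg : st.forest.leaves[i] with
      | none => exact absurd (hg ▸ List.getElem_mem hi) (Forest.find_eq_none.1 h)
      | some y => exact ⟨y, rfl⟩
    · rw [hl]
      simp
    · intro i hi y
      rw [hl, List.append_assoc, List.getElem?_append]
      split_ifs with hlt
      · rfl
      · rw [List.getElem?_append_right (by simp; omega), List.getElem?_replicate,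
          List.getElem?_eq_none (by omega)]
        split_ifs <;> simp
  | some z =>
    obtain ⟨k, p⟩ := z
    obtain ⟨h1, h2, h3⟩ := Forest.of_find h
    have hpos := Forest.find_pos none st.forest
    rw [h, Option.map_some] at hpos
    have hlen := st.forest.length_leaves
    have hlt := Forest.pos_lt h1 h2
    have hl : (st.insert x).forest.leaves =
        st.forest.leaves.set (treeOffset st.m k + pathPos p) (some x) := by
      rw [insert_of_find h, Forest.leaves_set _ h1 h2]
    refine ⟨_, mapping_of_store (j := treeOffset st.m k + pathPos p) hu hu' ?_ ?_ ?_ ?_⟩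
    · simp [Forest.leaves_getElem? _ h1 h2, h3]
    · intro i hi
      -- The filled leaf is the first vacant one in the global numbering, so every smaller index is
      -- in use.
      rw [eq_comm, List.idxOf?, List.findIdx?_eq_some_iff_getElem] at hpos
      obtain ⟨hb, -, hall⟩ := hpos
      have := hall i hi
      rw [List.getElem?_eq_getElem (by omega)]
      cases hg : st.forest.leaves[i] with
      | none => simp [hg] at this
      | some y => exact ⟨y, rfl⟩
    · rw [hl, List.getElem?_set_self (by omega)]
    · intro i hi y
      rw [hl, List.getElem?_set_ne (Ne.symm hi)]

theorem mapping_delete {st : ACA D} (hu : Uniq st.forest.leaves) {x : D} {k : ℕ} {p : List Bool}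
    (h : st.forest.find (some x) = some (k, p)) :
    (st.delete x).mapping = Function.update st.mapping x none := by
  obtain ⟨h1, h2, h3⟩ := Forest.of_find h
  have hl : (st.delete x).forest.leaves =
      st.forest.leaves.set (treeOffset st.m k + pathPos p) none := by
    rw [delete_of_find hu h, Forest.leaves_set _ h1 h2]
  have hu' : Uniq (st.delete x).forest.leaves := hl ▸ hu.set_none _
  have hg := st.forest.leaves_getElem? h1 h2
  rw [h3] at hg
  funext y
  by_cases hy : y = x
  · subst hy
    rw [Function.update_self, mapping_eq_none, hl]
    intro hmem
    obtain ⟨i, hi⟩ := List.mem_iff_getElem?.1 hmem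
    rw [List.getElem?_set] at hi
    split_ifs at hi with h4
    · simp at hi
    · exact h4 (uniq_iff.1 hu _ _ _ hg hi)
  · rw [Function.update_of_ne hy]
    refine mapping_congr hu hu' fun i => ?_
    rw [hl, List.getElem?_set]
    split_ifs with h4 h5
    · subst h4
      simp [hg, Ne.symm hy]
    · subst h4
      simp [hg, Ne.symm hy]
    · rfl

/-- One leaf has only one content; whether an FID is stored twice does not matter here. -/
theorem mapping_injective (st : ACA D) {x y : D} {i : ℕ} (hx : st.mapping x = some i)
    (hy : st.mapping y = some i) : x = y := by
  rw [mapping_eq] at hx hy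
  obtain ⟨⟨k, p⟩, hk, h1⟩ := Option.map_eq_some_iff.1 hx
  obtain ⟨⟨k', p'⟩, hk', h2⟩ := Option.map_eq_some_iff.1 hy
  obtain ⟨a1, a2, a3⟩ := Forest.of_find hk
  obtain ⟨b1, b2, b3⟩ := Forest.of_find hk'
  have e1 := st.forest.leaves_getElem? a1 a2
  have e2 := st.forest.leaves_getElem? b1 b2
  have e : treeOffset st.m k + pathPos p = treeOffset st.m k' + pathPos p' := by
    simp only at h1 h2; omega
  rw [e, e2, a3, b3] at e1
  simpa using e1.symm

theorem mapping_mem_Icc {st : ACA D} {x : D} {i : ℕ} (h : st.mapping x = some i) :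
    1 ≤ i ∧ i ≤ 2 ^ st.m - 1 := by
  rw [mapping_eq] at h
  obtain ⟨⟨k, p⟩, hk, h1⟩ := Option.map_eq_some_iff.1 h
  obtain ⟨a1, a2, -⟩ := Forest.of_find hk
  have := Forest.pos_lt a1 a2
  simp only at h1
  omega

end ACA

/-! ### What the blockchain shows, and claims against the latest vector -/

variable {File : Type} (S : HashSuite D File)

theorem mapping_insert_self {st : ACA D} (hu : Uniq st.forest.leaves) {x : D}
    (hx : some x ∉ st.forest.leaves) (head : D) :
    (st.insert x).mapping x = some (makeUpload S st x head).index := by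
  rw [ACA.mapping_eq]
  cases h : st.forest.find none with
  | none =>
    rw [makeUpload_of_full S hx h, ACA.insert_of_full h, Forest.find, Forest.find_merge hx]
    simp [treeOffset_of_le, add_comm]
  | some z =>
    obtain ⟨k, p⟩ := z
    rw [makeUpload_of_find S hu hx h, ACA.insert_of_find h, ACA.find_insert_of_find hu hx h]
    simp only [Option.map_some, Option.some.injEq]
    omega

/-- Later requests for other FIDs leave the index of `x` alone, so the latest record about `x` stays
valid. -/
theorem lookupIndex_honestLog {reqs : List (Request D)} (h : Valid reqs) (x : D) :
    lookupIndex (honestLog S reqs) x = (state reqs).mapping x := by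
  induction reqs with
  | nil => exact (ACA.mapping_eq_none.2 (by simp [state, ACA.gen, Forest.leaves_empty])).symm
  | cons r reqs ih =>
    have hu := uniq_state h.tail
    cases r with
    | upload y =>
      obtain ⟨i, -, hm⟩ := ACA.mapping_insert hu h.notMem
      rw [honestLog, lookupIndex, state]
      split_ifs with hy
      · rw [← show y = x from hy, mapping_insert_self S hu h.notMem]
      · rw [hm, Function.update_of_ne (show x ≠ y from Ne.symm hy), ih h.tail]
    | delete y =>
      obtain ⟨k, p, hf⟩ := h.exists_find
      rw [honestLog, lookupIndex, state, ACA.mapping_delete hu hf]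
      split_ifs with hy
      · rw [← show y = x from hy, Function.update_self]
      · rw [Function.update_of_ne (show x ≠ y from Ne.symm hy), ih h.tail]

theorem dbSize_honestLog (reqs : List (Request D)) :
    dbSize (honestLog S reqs) = 2 ^ (state reqs).m - 1 := by
  cases reqs with
  | nil => simp [honestLog, dbSize, state, ACA.gen]
  | cons r reqs => cases r <;> simp [honestLog, dbSize, state, makeUpload, makeDelete]

theorem verifyClaim_ledgerOf_iff (st : ACA D) (x : D) (i : ℕ) (w : Witness D) :
    verifyClaim S (st.forest.roots S.node) x i w = true ↔
      (entry w.length (st.forest.roots S.node)).val.1 =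
        some (recompute S.node w (some x)).val ∧
      i = 1 + treeOffset st.m w.length + (pathOffset 0 w).val := by
  simp [verifyClaim, treeOffset]

theorem exists_verifyClaim {st : ACA D} {x : D} {i : ℕ} (h : st.mapping x = some i) :
    ∃ w, verifyClaim S (st.forest.roots S.node) x i w = true := by
  rw [ACA.mapping_eq] at h
  obtain ⟨⟨k, p⟩, hk, h1⟩ := Option.map_eq_some_iff.1 h
  obtain ⟨a1, a2, -⟩ := Forest.of_find hk
  refine ⟨st.forest.path S.node k p, ?_⟩
  rw [verifyClaim_ledgerOf_iff, Forest.length_path _ _ a1 a2, Forest.pathOffset_path _ _ a1 a2,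
    entry_ledgerOf S hk]
  simp only at h1
  exact ⟨rfl, by omega⟩

/-- Without a collision the witness leads to a leaf that stores `x`, which by uniqueness is the leaf
of its index. A claim counts the leaves of all larger trees, empty or not, because deletions may
have emptied some. -/
theorem mapping_of_verifyClaim {st : ACA D} (hu : Uniq st.forest.leaves) {x : D} {i : ℕ}
    {w : Witness D} (h : verifyClaim S (st.forest.roots S.node) x i w = true) :
    st.mapping x = some i ∨
      CollisionIn S.node (st.forest.hashInputs S.node ++ pathInputs S.node w (some x)) := by
  by_cases hc : CollisionIn S.node (st.forest.hashInputs S.node ++ pathInputs S.node w (some x))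
  · exact Or.inr hc
  left
  rw [verifyClaim_ledgerOf_iff] at h
  obtain ⟨h1, h2⟩ := h
  obtain ⟨hw, hg⟩ := st.forest.path_of_recompute h1 hc
  have hk := lt_of_entry_eq_some h1
  rw [Forest.length_roots] at hk
  rw [ACA.mapping_eq, Forest.find_of_get hu hk (by simp) hg, h2, hw,
    Forest.pathOffset_path _ _ hk (by simp), ← hw]
  simp only [Option.map_some, Option.some.injEq]
  omega

/-- The client's hash check makes any output a preimage of the FID; nothing is assumed of the log,
the scheme or the miner. -/
theorem retrieveSingle_mem_support (P : SinglePIR File) (l : ℕ) (log : Log D) (x : D) (g : File)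
    (miner : List Bool → P.Ans) (hg : S.file g = x) (y : Option File × List (List Bool))
    (hy : y ∈ (P.exec l miner (retrieveSingle S log x)).support) :
    y.1 = none ∨ y.1 = some g ∨ ∃ g', y.1 = some g' ∧ g' ≠ g ∧ S.file g' = S.file g := by
  have key : y.1 = none ∨ ∃ g', y.1 = some g' ∧ S.file g' = x := by
    rw [retrieveSingle] at hy
    cases hi : lookupIndex log x with
    | none =>
      rw [hi] at hy
      left
      simp only [SinglePIR.exec, PMF.support_pure, Set.mem_singleton_iff] at hy
      rw [hy]
    | some i =>
      rw [hi] at hy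
      simp only [SinglePIR.exec, PMF.mem_support_bind_iff, PMF.pure_map, PMF.support_pure,
        Set.mem_singleton_iff] at hy
      obtain ⟨z, -, rfl⟩ := hy
      cases hr : (P.decrypt l z.2 (miner z.1)).filter fun g => decide (S.file g = x) with
      | none => exact Or.inl rfl
      | some g' =>
        right
        rw [Option.filter_eq_some_iff] at hr
        exact ⟨g', rfl, by simpa using hr.2⟩
  rcases key with h | ⟨g', h1, h2⟩
  · exact Or.inl h
  · by_cases hgg : g' = g
    · exact Or.inr (Or.inl (hgg ▸ h1))
    · exact Or.inr (Or.inr ⟨g', h1, hgg, h2.trans hg.symm⟩)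

end

/-! ### Assembly of public verifiability -/

theorem publicVerifiability : PublicVerifiability := by
  intro D File _ S
  refine ⟨fun reqs h => by rw [replay_honestLog S h]; rfl,
    fun log hv h => ⟨honestLog_or_collision S hv h, length_logInputs_le S hv h⟩,
    fun reqs x h => ACA.mapping_insert (uniq_state h.tail) h.notMem, ?_, ?_, ?_,
    retrieveSingle_mem_support S⟩
  · intro reqs x h
    obtain ⟨k, p, hf⟩ := h.exists_find
    exact ACA.mapping_delete (uniq_state h.tail) hf
  · exact fun reqs h => ⟨fun x y i => (state reqs).mapping_injective, lookupIndex_honestLog S h⟩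
  · intro reqs L hv hL x i
    rw [replay_honestLog S hv, Option.some.injEq] at hL
    subst hL
    exact ⟨exists_verifyClaim S, fun w => mapping_of_verifyClaim S (uniq_state hv)⟩

/-! ## Distributions -/

theorem bind_congr_of_mem_support {α β : Type*} {p : PMF α} {f g : α → PMF β}
    (h : ∀ a ∈ p.support, f a = g a) : p.bind f = p.bind g := by
  ext b
  rw [PMF.bind_apply, PMF.bind_apply]
  refine tsum_congr fun a => ?_
  by_cases ha : a ∈ p.support
  · rw [h a ha]
  · rw [(PMF.apply_eq_zero_iff p a).2 ha, zero_mul, zero_mul]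

theorem map_uniformOfFinset {α β : Type*} [DecidableEq β] {X : Finset α} (hX : X.Nonempty)
    {f : α → β} (hf : Set.InjOn f X) :
    (PMF.uniformOfFinset X hX).map f = PMF.uniformOfFinset (X.image f) (hX.image f) := by
  classical
  ext b
  rw [PMF.map_apply]
  by_cases hb : b ∈ X.image f
  · obtain ⟨a, ha, rfl⟩ := Finset.mem_image.1 hb
    rw [tsum_eq_single a, if_pos rfl, PMF.uniformOfFinset_apply_of_mem _ ha,
      PMF.uniformOfFinset_apply_of_mem _ hb, Finset.card_image_of_injOn hf]
    intro a' ha'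
    split_ifs with h
    · exact PMF.uniformOfFinset_apply_of_notMem _ fun hm => ha' (hf hm ha h.symm)
    · rfl
  · rw [PMF.uniformOfFinset_apply_of_notMem _ hb, ENNReal.tsum_eq_zero]
    intro a
    split_ifs with h
    · exact PMF.uniformOfFinset_apply_of_notMem _ fun hm =>
        hb (h ▸ Finset.mem_image_of_mem f hm)
    · rfl

theorem map_uniformOfFintype_equiv {α : Type*} [Fintype α] [Nonempty α] (e : α ≃ α) :
    (PMF.uniformOfFintype α).map e = PMF.uniformOfFintype α := by
  classical
  ext b
  rw [PMF.map_apply, tsum_eq_single (e.symm b), if_pos (by simp), PMF.uniformOfFintype_apply,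
    PMF.uniformOfFintype_apply]
  intro a ha
  rw [if_neg]
  rintro rfl
  simp at ha

/-- A guess that is independent of a uniformly drawn element is right with probability at most one
over the number of elements. -/
theorem uniform_guess_le {α : Type*} {X : Finset α} (hX : X.Nonempty) {f : α → ℕ}
    (hf : Set.InjOn f X) (G : PMF ℕ) :
    ((PMF.uniformOfFinset X hX).bind (fun x => G.map fun g => decide (g = f x)) true).toReal ≤
      1 / (X.card : ℝ) := by
  classical
  have hG : ∀ x, (G.map fun g => decide (g = f x)) true = G (f x) := by
    intro x
    rw [PMF.map_apply, tsum_eq_single (f x)]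
    · simp
    · intro g hg
      simp [hg]
  have hle : (PMF.uniformOfFinset X hX).bind (fun x => G.map fun g => decide (g = f x)) true ≤
      (X.card : ENNReal)⁻¹ := by
    rw [PMF.bind_apply, tsum_eq_sum (s := X)]
    -- The values `f x` are distinct, so the probabilities of guessing them add up to at most `1`.
    · calc ∑ x ∈ X, PMF.uniformOfFinset X hX x * (G.map fun g => decide (g = f x)) true
          = ∑ x ∈ X, (X.card : ENNReal)⁻¹ * G (f x) := Finset.sum_congr rfl fun x hx => by
            rw [hG, PMF.uniformOfFinset_apply_of_mem _ hx]
        _ = (X.card : ENNReal)⁻¹ * ∑ b ∈ X.image f, G b := by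
            rw [← Finset.mul_sum, Finset.sum_image hf]
        _ ≤ (X.card : ENNReal)⁻¹ * 1 := by
            gcongr
            exact (ENNReal.sum_le_tsum _).trans_eq G.tsum_coe
        _ = _ := mul_one _
    · intro x hx
      rw [PMF.uniformOfFinset_apply_of_notMem _ hx, zero_mul]
  have := ENNReal.toReal_mono (by simp [hX.ne_empty]) hle
  simpa using this

/-! ## Privacy of the single-miner protocol -/

section

variable {D : Type} [DecidableEq D]

/-- The index of a stored FID. -/
def indexOf (reqs : List (Request D)) (x : D) : ℕ := ((state reqs).mapping x).getD 0

theorem mapping_eq_some_indexOf {reqs : List (Request D)} {x : D}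
    (h : (state reqs).mapping x ≠ none) : (state reqs).mapping x = some (indexOf reqs x) := by
  obtain ⟨i, hi⟩ := Option.ne_none_iff_exists'.1 h
  rw [indexOf, hi, Option.getD_some]

theorem injOn_indexOf {reqs : List (Request D)} {X : Finset D}
    (h : ∀ x ∈ X, (state reqs).mapping x ≠ none) : Set.InjOn (indexOf reqs) X := by
  intro x hx y hy hxy
  have h1 := mapping_eq_some_indexOf (h x hx)
  rw [hxy] at h1
  exact (state reqs).mapping_injective h1 (mapping_eq_some_indexOf (h y hy))

theorem lookupIndex_eq_indexOf {File : Type} (S : HashSuite D File) {reqs : List (Request D)}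
    (hv : Valid reqs) {x : D} (h : (state reqs).mapping x ≠ none) :
    lookupIndex (honestLog S reqs) x = some (indexOf reqs x) := by
  rw [lookupIndex_honestLog S hv, mapping_eq_some_indexOf h]

/-- The miner receives exactly one query, sent before it answers, so its behaviour has no influence
on the view; relabelling FIDs by their indices keeps the distribution uniform. -/
theorem retrievalGame_eq {File : Type} (P : SinglePIR File) (S : HashSuite D File) (A : Adversary)
    (l : ℕ) (miner : List Bool → P.Ans) {reqs : List (Request D)} (hv : Valid reqs)
    (X : Finset D) (hX : X.Nonempty) (h : ∀ x ∈ X, (state reqs).mapping x ≠ none) :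
    P.retrievalGame S A l miner (honestLog S reqs) X hX =
      P.game A l (dbSize (honestLog S reqs)) (X.image (indexOf reqs)) (hX.image _) := by
  rw [SinglePIR.retrievalGame, SinglePIR.game, ← map_uniformOfFinset hX (injOn_indexOf h),
    PMF.bind_map]
  refine bind_congr_of_mem_support fun x hx => ?_
  rw [PMF.mem_support_uniformOfFinset_iff] at hx
  have hl := lookupIndex_eq_indexOf S hv (h x hx)
  simp only [retrieveSingle, hl, SinglePIR.exec, PMF.pure_map, PMF.bind_bind, PMF.pure_bind,
    Function.comp, Option.some.injEq, eq_comm (a := indexOf reqs x)]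

theorem singlePrivacy : SinglePrivacy := by
  intro D File _ P hP S reqs A miner X hX hv hpoly hstored
  obtain ⟨q, hq⟩ := hpoly
  obtain ⟨ε, hε, hle⟩ := hP A (fun l => dbSize (honestLog (S l) (reqs l)))
    -- The size is at most twice the peak (or twice `1`), and the peak is at most the number of
    -- requests, which `q` bounds.
    ⟨2 * (q + 1), fun l => by
      have h1 := two_pow_le_peak (hv l)
      have h2 := peak_le_length (hv l)
      have h3 := hq l
      simp only [dbSize_honestLog, Polynomial.eval_mul, Polynomial.eval_add, Polynomial.eval_one,
        Polynomial.eval_ofNat] at h3 ⊢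
      omega⟩
    (fun l => (X l).image (indexOf (reqs l))) (fun l => (hX l).image _) (fun l i hi => by
      obtain ⟨x, hx, rfl⟩ := Finset.mem_image.1 hi
      rw [dbSize_honestLog, Finset.mem_Icc]
      exact ACA.mapping_mem_Icc (mapping_eq_some_indexOf (hstored l x hx)))
  refine ⟨ε, hε, fun l => ?_⟩
  rw [retrievalGame_eq P (S l) A l (miner l) (hv l) (X l) (hX l) (hstored l)]
  have := hle l
  rwa [Finset.card_image_of_injOn (injOn_indexOf (hstored l))] at this

end

/-! ## Privacy of the multi-miner protocol -/

section

variable {F : Type} [Field F] {N : ℕ}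

/-- A polynomial of degree at most `t` without constant term that takes a given value at up to `t`
nonzero points. -/
theorem exists_share {t : ℕ} {pts : Fin N → F} (hinj : Function.Injective pts)
    (hne : ∀ i, pts i ≠ 0) {T : Finset (Fin N)} (hT : T.card ≤ t) (a : F) :
    ∃ d : Fin t → F, ∀ i ∈ T, ∑ e : Fin t, d e * pts i ^ ((e : ℕ) + 1) = a := by
  -- For `t = 0` the set is empty; the strict degree bound below would fail, since the zero
  -- polynomial has `natDegree` zero.
  rcases Nat.eq_zero_or_pos t with rfl | ht
  · refine ⟨fun _ => 0, fun i hi => ?_⟩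
    simp [Finset.card_eq_zero.1 (Nat.le_zero.1 hT)] at hi
  -- Then `X * Q` has no constant term, degree at most `t`, and the value `a` at the points of `T`.
  -- Division is possible as the points are nonzero.
  set Q := Lagrange.interpolate T pts fun i => a / pts i
  have hdeg : Q.degree < t :=
    (Lagrange.degree_interpolate_lt _ hinj.injOn).trans_le (by exact_mod_cast hT)
  have hnat : Q.natDegree < t := by
    by_cases h0 : Q = 0
    · rwa [h0, Polynomial.natDegree_zero]
    · rwa [Polynomial.natDegree_lt_iff_degree_lt h0]
  refine ⟨fun e => Q.coeff e, fun i hi => ?_⟩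
  have h1 : Q.eval (pts i) = a / pts i := Lagrange.eval_interpolate_at_node _ hinj.injOn hi
  rw [Polynomial.eval_eq_sum_range' hnat, ← Fin.sum_univ_eq_sum_range
    (fun e => Q.coeff e * pts i ^ e)] at h1
  rw [eq_div_iff (hne i), Finset.sum_mul] at h1
  rw [← h1]
  exact Finset.sum_congr rfl fun e _ => by ring

variable [Fintype F]

/-- What a coalition of at most `t` servers receives has the same distribution for all indices. -/
theorem multiQuery_view_eq {t : ℕ} {pts : Fin N → F} (hinj : Function.Injective pts)
    (hne : ∀ i, pts i ≠ 0) {T : Finset (Fin N)} (hT : T.card ≤ t) (size i i' : ℕ) :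
    ((multiQuery t pts size i).map fun q (j : T) => q j) =
      (multiQuery t pts size i').map fun q (j : T) => q j := by
  -- At the points of `T`, the sharing polynomials `d` take the difference of the two unit vectors.
  -- Uniform coefficients remain uniform when `d` is added, and this addition turns the shares for
  -- `i` into those for `i'`.
  choose d hd using fun j : Fin size => exists_share hinj hne hT
    ((if (j : ℕ) + 1 = i' then (1 : F) else 0) - if (j : ℕ) + 1 = i then 1 else 0)
  rw [multiQuery, multiQuery, PMF.map_comp, PMF.map_comp,
    ← map_uniformOfFintype_equiv (Equiv.addRight d), PMF.map_comp,
    map_uniformOfFintype_equiv (Equiv.addRight d)]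
  congr 1
  funext c j
  simp only [Function.comp_apply]
  congr 1
  funext b
  have := hd b j j.2
  simp only [Equiv.coe_addRight, Pi.add_apply, add_mul, Finset.sum_add_distrib, this]
  ring

end

theorem multiPrivacy : MultiPrivacy := by
  intro D F _ _ _ _ f s S pts hinj hne reqs hv miners T hT guess X hX hstored
  set size := dbSize (honestLog S reqs)
  -- The reference view uses index `0`, a sharing of the zero vector because entries are counted
  -- from `1`; any fixed index would do.
  set G : PMF ℕ := ((multiQuery f pts size 0).map fun q (j : T) => q j).bind fun v => guess [v]
  have key : multiRetrievalGame f (2 * f + 1) pts miners T guess (honestLog S reqs) X hX =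
      (PMF.uniformOfFinset X hX).bind fun x => G.map fun g => decide (g = indexOf reqs x) := by
    rw [multiRetrievalGame]
    refine bind_congr_of_mem_support fun x hx => ?_
    rw [PMF.mem_support_uniformOfFinset_iff] at hx
    have hl := lookupIndex_eq_indexOf S hv (hstored x hx)
    simp only [retrieveMulti, hl, multiExec, PMF.pure_map, PMF.bind_bind, PMF.pure_bind,
      Option.some.injEq, eq_comm (a := indexOf reqs x), List.map_cons, List.map_nil]
    rw [show G = ((multiQuery f pts size (indexOf reqs x)).map fun q (j : T) => q j).bind
      fun v => guess [v] from by rw [multiQuery_view_eq hinj hne hT size _ 0], PMF.map_bind,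
      PMF.bind_map]
    rfl
  rw [key]
  exact uniform_guess_le hX (injOn_indexOf hstored) G

/-! ## The database of a miner -/

section

variable {D : Type} [DecidableEq D] {File : Type}

theorem database_getElem? {reqs : List (Request D)} (hv : Valid reqs) (blank : File)
    (files : D → File) {x : D} (hx : (state reqs).mapping x ≠ none) :
    (database blank files (state reqs)).val[indexOf reqs x - 1]? = some (files x) := by
  have h := (ACA.mapping_eq_some (uniq_state hv)).1 (mapping_eq_some_indexOf hx)
  simp [database, h.2]

theorem length_database (blank : File) (files : D → File) (reqs : List (Request D)) :
    (database blank files (state reqs)).val.length = 2 ^ (state reqs).m - 1 := by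
  have := (state reqs).forest.length_leaves
  simp only [database, mapList_val, List.length_map]
  omega

theorem database_cost (blank : File) (files : D → File) (reqs : List (Request D)) :
    (database blank files (state reqs)).cost = 2 ^ (state reqs).m - 1 := by
  have := (state reqs).forest.length_leaves
  simp only [database, mapList_cost]
  omega

theorem two_pow_le {reqs : List (Request D)} (hv : Valid reqs) {n : ℕ} (hn : peak reqs ≤ n)
    (h1 : 1 ≤ n) : 2 ^ (state reqs).m ≤ 2 * n :=
  (two_pow_le_peak hv).trans (by omega)

end

/-! ## Robustness of the multi-miner protocol -/

section

variable {F : Type} [Field F] {N s : ℕ}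

theorem multiAnswer_ofFn {n : ℕ} (a : Fin n → F) (b : Fin n → Fin s → F) :
    (multiAnswer (List.ofFn a) (List.ofFn b)).val = fun w => ∑ j, a j * b j w := by
  induction n with
  | zero => rfl
  | succ n ih =>
    simp only [List.ofFn_succ, multiAnswer, val_bind, val_pure, ih, Fin.sum_univ_succ]

theorem multiAnswer_cost_le (q : List F) (db : List (Fin s → F)) :
    (multiAnswer q db).cost ≤ (s + 1) * db.length := by
  induction db generalizing q with
  | nil => cases q <;> simp [multiAnswer]
  | cons b db ih =>
    cases q with
    | nil => simp [multiAnswer]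
    | cons a q =>
      have := ih q
      simp only [multiAnswer, cost_bind, cost_tick, cost_pure, add_zero, List.length_cons]
      linarith

/-- A polynomial of degree at most `t` that vanishes at `t + 1` distinct points is zero
(Vandermonde); `orderEmbOfCardLe` picks these points from `T`. -/
theorem coeff_eq_of_agree {t : ℕ} {pts : Fin N → F} (hinj : Function.Injective pts)
    {T : Finset (Fin N)} (hT : t + 1 ≤ T.card) {c c' : Fin (t + 1) → F}
    (h : ∀ i ∈ T, ∑ e, c e * pts i ^ (e : ℕ) = ∑ e, c' e * pts i ^ (e : ℕ)) : c = c' := by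
  rw [← sub_eq_zero]
  refine Matrix.eq_zero_of_forall_index_sum_mul_pow_eq_zero
    (f := fun j => pts (T.orderEmbOfCardLe hT j))
    (hinj.comp (T.orderEmbOfCardLe hT).injective) fun j => ?_
  have := h _ (T.orderEmbOfCardLe_mem hT j)
  simp only [Pi.sub_apply, sub_mul, Finset.sum_sub_distrib, this, sub_self]

variable [Fintype F]

variable {D : Type} [DecidableEq D]

/-- All correct answers lie on polynomials of degree at most `t` whose constant terms form the
requested block. -/
theorem exists_answer_coeff {t : ℕ} {pts : Fin N → F} {reqs : List (Request D)} (hv : Valid reqs)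
    (files : D → Fin s → F) {x : D} (hx : (state reqs).mapping x ≠ none) {q : Fin N → List F}
    (hq : q ∈ (multiQuery t pts (2 ^ (state reqs).m - 1) (indexOf reqs x)).support) :
    ∃ c : Fin s → Fin (t + 1) → F, (fun w => c w 0) = files x ∧
      ∀ i, (multiMinerAnswer files (state reqs) (q i)).val =
        fun w => ∑ e, c w e * pts i ^ (e : ℕ) := by
  obtain ⟨i₁, i₂⟩ := ACA.mapping_mem_Icc (mapping_eq_some_indexOf hx)
  have hget := database_getElem? hv (fun _ => 0) files hx
  have hlen := length_database (fun _ => 0) files reqs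
  simp only [multiMinerAnswer, val_bind]
  generalize (database (fun _ => 0) files (state reqs)).val = db at hget hlen
  rw [← hlen] at hq i₂
  obtain ⟨a, -, rfl⟩ := (PMF.mem_support_map_iff _ _ _).1 hq
  -- Multiplication by the database is linear: the unit vector contributes the file as constant
  -- term, and the coefficients of degree `e + 1` contribute their product with the database.
  refine ⟨fun w => Fin.cons (files x w) fun e => ∑ j, a j e * db.get j w, rfl, fun i => ?_⟩
  have hlt : indexOf reqs x - 1 < db.length := by omega
  rw [List.getElem?_eq_getElem hlt, Option.some.injEq] at hget
  have hsum : ∀ w, ∑ j : Fin db.length,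
      (if (j : ℕ) + 1 = indexOf reqs x then (1 : F) else 0) * db.get j w = files x w := by
    intro w
    rw [Finset.sum_eq_single ⟨indexOf reqs x - 1, hlt⟩]
    · rw [if_pos (by simp only; omega), one_mul, ← hget]
      rfl
    · intro j _ hj
      rw [if_neg, zero_mul]
      intro h
      exact hj (Fin.ext (by simp only; omega))
    · simp
  have hans := multiAnswer_ofFn (fun j : Fin db.length =>
    (if (j : ℕ) + 1 = indexOf reqs x then (1 : F) else 0) +
      ∑ e : Fin t, a j e * pts i ^ ((e : ℕ) + 1)) db.get
  rw [List.ofFn_get] at hans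
  refine hans.trans (funext fun w => ?_)
  simp only [add_mul, Finset.sum_add_distrib, hsum, Fin.sum_univ_succ, Fin.cons_zero, Fin.cons_succ,
    Fin.val_zero, pow_zero, mul_one, Fin.val_succ, Finset.sum_mul]
  congr 1
  rw [Finset.sum_comm]
  exact Finset.sum_congr rfl fun e _ => Finset.sum_congr rfl fun j _ => by ring

variable [DecidableEq F]

/-- If at least `2 f + 1` of `3 f + 1` responses lie on given polynomials of degree at most `f`,
reconstruction succeeds with these. -/
theorem reconstruct_eq {f : ℕ} {pts : Fin (3 * f + 1) → F} (hinj : Function.Injective pts)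
    {resp : Fin (3 * f + 1) → Option (Fin s → F)} {c : Fin s → Fin (f + 1) → F}
    (hc : 2 * f + 1 ≤ (agreeSet pts resp c).card) :
    reconstruct f (2 * f + 1) pts resp = some (agreeSet pts resp c, fun w => c w 0) := by
  -- The decoder's condition on the number of responses always holds, because `(3 f + 1) f < (2 f +
  -- 1) ^ 2`.
  have hk : (Finset.univ.filter fun i => (resp i).isSome = true).card * f < (2 * f + 1) ^ 2 := by
    have : (Finset.univ.filter fun i => (resp i).isSome = true).card ≤ 3 * f + 1 := by
      simpa using Finset.card_le_univ (Finset.univ.filter fun i => (resp i).isSome = true)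
    nlinarith
  have huniq : ∀ c', 2 * f + 1 ≤ (agreeSet pts resp c').card → c' = c := by
    intro c' hc'
    -- Two sets of `2 f + 1` among `3 f + 1` servers share at least `f + 1`, enough to determine
    -- polynomials of degree at most `f`.
    have hunion := Finset.card_union_add_card_inter (agreeSet pts resp c') (agreeSet pts resp c)
    have hle : (agreeSet pts resp c' ∪ agreeSet pts resp c).card ≤ 3 * f + 1 := by
      simpa using Finset.card_le_univ (agreeSet pts resp c' ∪ agreeSet pts resp c)
    funext w
    refine coeff_eq_of_agree hinj (T := agreeSet pts resp c' ∩ agreeSet pts resp c) (by omega)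
      fun i hi => ?_
    simp only [agreeSet, Finset.mem_inter, Finset.mem_filter, Finset.mem_univ, true_and] at hi
    have := hi.1.symm.trans hi.2
    exact congrFun (Option.some.inj this) w
  have hlist : decodeList f (2 * f + 1) pts resp =
      {(agreeSet pts resp c, fun w => c w 0)} := by
    rw [decodeList, if_pos hk]
    have : (Finset.univ.filter fun c' : Fin s → Fin (f + 1) → F =>
        2 * f + 1 ≤ (agreeSet pts resp c').card) = {c} := by
      ext c'
      simp only [Finset.mem_filter, Finset.mem_univ, true_and, Finset.mem_singleton]
      exact ⟨huniq c', fun h => h ▸ hc⟩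
    rw [this, Finset.image_singleton]
  have hex : ∃ x, decodeList f (2 * f + 1) pts resp = {x} := ⟨_, hlist⟩
  rw [reconstruct, dif_pos hex]
  exact congrArg some (Finset.singleton_injective (hex.choose_spec.symm.trans hlist))

end

theorem sqrt_lt_honest (N : ℕ) (hN : 1 ≤ N) :
    Real.sqrt ((N : ℝ) * ((N : ℝ) - 1) / 3) < (2 * (N : ℝ) + 1) / 3 := by
  have h : (1 : ℝ) ≤ N := by exact_mod_cast hN
  rw [Real.sqrt_lt' (by positivity)]
  nlinarith

theorem robustness : Robustness := by
  refine ⟨sqrt_lt_honest, ?_⟩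
  intro D F _ _ _ _ f s S pts hinj hne reqs hv files miners B hB hmin x hx y hy
  have hl := lookupIndex_eq_indexOf S hv hx
  simp only [retrieveMulti, hl, multiExec, PMF.pure_map, PMF.mem_support_bind_iff,
    PMF.support_pure, Set.mem_singleton_iff, dbSize_honestLog] at hy
  obtain ⟨q, hq, rfl⟩ := hy
  obtain ⟨c, hc0, hc⟩ := exists_answer_coeff hv files hx hq
  have hmem : ∀ i, i ∈ agreeSet pts (miners q) c ↔
      miners q i = some (multiMinerAnswer files (state reqs) (q i)).val := by
    intro i
    simp [agreeSet, hc i]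
  have hsub : Bᶜ ⊆ agreeSet pts (miners q) c := by
    intro i hi
    rw [hmem]
    exact hmin q i (Finset.mem_compl.1 hi)
  -- At least `3 f + 1 - f = 2 f + 1` miners agree. The agreement set may also contain members of
  -- `B` that happened to answer correctly.
  have hcard := Finset.card_le_card hsub
  rw [Finset.card_compl, Fintype.card_fin] at hcard
  refine ⟨q, agreeSet pts (miners q) c, rfl, ?_, fun i => not_congr (hmem i)⟩
  rw [reconstruct_eq hinj (c := c) (by omega), hc0]

/-! ## Efficiency -/

section

variable {D : Type} [DecidableEq D] {File : Type} (S : HashSuite D File)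

theorem check_cost {α : Type} (b : Bool) (next : Timed (Option α)) :
    (check b next).cost = if b = true then next.cost else 0 := by
  cases b <;> rfl

theorem ite_zero_le (P : Prop) [Decidable P] (a : ℕ) : (if P then a else 0) ≤ a := by
  split_ifs <;> simp

/-- Checks can only shorten a run, so each is replaced by its continuation, except the length check:
it is what bounds all later passes by the verifier's own `m`, however long the submitted lists are.
-/
theorem verifyUpload_cost_le {L : Ledger D} {m : ℕ} (hL : L.vec.length = m)
    (hfill : (occFill m L.occ).cost ≤ 2 * m) (x : D) (q : UploadProof D) :
    (verifyUpload S L x q).cost ≤ 40 * m + 40 := by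
  have h1 := atMost_cost_le q.wit L.vec
  have h2 := atMost_cost_le q.vec (none :: L.vec)
  have h3 := agreeOff_cost_le q.wit.length q.vec L.vec
  have h4 := fun p => eqList_cost_le (q.wit.map Prod.snd).reverse p
  have h5 := fun p => eqList_cost_le q.vec p
  have h6 := fun p => eqList_cost_le q.wit p
  simp only [List.length_cons, List.length_reverse, List.length_map] at h2 h4
  simp only [verifyUpload, cost_bind, check_cost, cost_tick, atMost_val, size_val, size_cost,
    entry_cost, recompute_cost, assignIndex_cost, directions_val, directions_cost,
    Bool.and_eq_true, decide_eq_true_eq, List.length_cons, hL]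
  rw [hL] at h1 h2 h3
  grw [ite_zero_le (q.fid = x ∧ _)]
  generalize (atMost q.wit L.vec).cost = c₁ at h1 ⊢
  generalize (atMost q.vec (none :: L.vec)).cost = c₂ at h2 ⊢
  by_cases hlen : q.wit.length ≤ m ∧ q.vec.length ≤ m + 1
  swap
  -- A proof that is too long costs only the two scans, which stop at the length of the ledger's
  -- vector.
  · rw [if_neg hlen]
    omega
  rw [if_pos hlen]
  grw [ite_zero_le, ite_zero_le]
  cases hf : (occFill m L.occ).val with
  | some z =>
    have h4' := h4 z.2.1
    simp only [cost_bind, check_cost, cost_tick, entry_cost, recompute_cost, cost_pure, hL]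
    grw [ite_zero_le, h3, h4', hfill]
    clear hfill h3 h4 h5 h6 h4' hf hL
    obtain ⟨h3, h4⟩ := hlen
    linarith
  | none =>
    have h5' := h5 (q.root :: L.vec.map fun _ => none)
    have h6' := h6 (L.vec.map fun r => (r, true)).reverse
    simp only [cost_bind, check_cost, cost_tick, mapList_cost, mapList_val, revList_cost,
      revList_val, cost_pure, List.length_map, hL]
    grw [ite_zero_le, h5', h6', hfill]
    clear hfill h3 h4 h5 h6 h5' h6' hf hL
    obtain ⟨h3, h4⟩ := hlen
    linarith

theorem verifyDelete_cost_le {L : Ledger D} {m : ℕ} (hL : L.vec.length = m)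
    (hocc : L.occ.length = m) (x : D) (q : DeleteProof D) :
    (verifyDelete S L x q).cost ≤ 40 * m + 40 := by
  have h1 := atMost_cost_le q.wit L.vec
  have h2 := atMost_cost_le q.vec L.vec
  have h3 := agreeOff_cost_le q.wit.length q.vec L.vec
  have h4 := occClear_cost_le q.wit.length (q.wit.map Prod.snd).reverse L.occ
  have h5 : (if q.wit.length < L.occ.length then q.wit.length + 1 else 0) ≤ q.wit.length + 1 := by
    split_ifs <;> omega
  simp only [List.length_reverse, List.length_map] at h4
  simp only [verifyDelete, cost_bind, check_cost, cost_tick, atMost_val, size_val, size_cost,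
    entry_cost, recompute_cost, directions_val, directions_cost, allEmpty_cost, cost_pure,
    Bool.and_eq_true, decide_eq_true_eq, hL]
  rw [hL] at h1 h2 h3
  grw [ite_zero_le (q.fid = x ∧ _)]
  generalize (atMost q.wit L.vec).cost = c₁ at h1 ⊢
  generalize (atMost q.vec L.vec).cost = c₂ at h2 ⊢
  by_cases hlen : q.wit.length ≤ m ∧ q.vec.length ≤ m
  swap
  · rw [if_neg hlen]
    omega
  rw [if_pos hlen]
  grw [ite_zero_le, ite_zero_le, h3, h4, h5, hocc]
  clear h3 h4 h5 hocc hL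
  omega

theorem verify_cost_le (st : ACA D) (head : D) (r : Request D) (q : Record D) :
    (verify S (ledgerOf S st head) r q).cost ≤ 40 * st.m + 40 := by
  have hL : (ledgerOf S st head).vec.length = st.m := st.forest.length_roots S.node
  cases r with
  | upload x =>
    cases q with
    | upload q => exact verifyUpload_cost_le S hL st.forest.fill_occs_cost_le x q
    | delete q => simp [verify]
  | delete x =>
    cases q with
    | upload q => simp [verify]
    | delete q => exact verifyDelete_cost_le S hL st.forest.length_occs x q

theorem verify_cost_le_log {st : ACA D} {n : ℕ} (hm : 2 ^ st.m ≤ 2 * n) (hn : 2 ≤ n) (head : D)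
    (r : Request D) (q : Record D) :
    ((verify S (ledgerOf S st head) r q).cost : ℝ) ≤ 120 / Real.log 2 * Real.log n := by
  have hlog : 0 < Real.log 2 := Real.log_pos (by norm_num)
  have h1 : ((verify S (ledgerOf S st head) r q).cost : ℝ) ≤ 40 * st.m + 40 := by
    exact_mod_cast verify_cost_le S st head r q
  have h2 : (2 : ℝ) ^ st.m ≤ 2 * n := by exact_mod_cast hm
  have hn' : (2 : ℝ) ≤ n := by exact_mod_cast hn
  have h3 := Real.log_le_log (by positivity) h2
  rw [Real.log_pow, Real.log_mul (by norm_num) (by linarith)] at h3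
  have h4 := Real.log_le_log (by norm_num) hn'
  -- From `2 ^ m ≤ 2 n` one has `m ≤ 1 + log₂ n`, so `40 m + 40 ≤ 80 + 40 log₂ n ≤ 120 log₂ n`, as
  -- `log₂ n ≥ 1`.
  rw [div_mul_eq_mul_div, le_div_iff₀ hlog]
  nlinarith

theorem exec_retrieveSingle {P : SinglePIR File} {reqs : List (Request D)} (hv : Valid reqs)
    {x : D} (hx : (state reqs).mapping x ≠ none) (l : ℕ) (miner : List Bool → P.Ans)
    {y : Option File × List (List Bool)}
    (hy : y ∈ (P.exec l miner (retrieveSingle S (honestLog S reqs) x)).support) :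
    ∃ z ∈ (P.query l (2 ^ (state reqs).m - 1) (indexOf reqs x)).support,
      y = ((P.decrypt l z.2 (miner z.1)).filter fun g => decide (S.file g = x), [z.1]) := by
  have hl := lookupIndex_eq_indexOf S hv hx
  simpa only [retrieveSingle, hl, SinglePIR.exec, PMF.pure_map, PMF.mem_support_bind_iff,
    PMF.support_pure, Set.mem_singleton_iff, dbSize_honestLog] using hy

theorem exec_retrieveSingle_correct {P : SinglePIR File} (hP : P.Correct)
    {reqs : List (Request D)} (hv : Valid reqs) (blank : File) (files : D → File) {x : D}
    (hx : (state reqs).mapping x ≠ none) (hfile : S.file (files x) = x) (l : ℕ)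
    {y : Option File × List (List Bool)}
    (hy : y ∈ (P.exec l (fun q => (P.minerAnswer l blank files (state reqs) q).val)
      (retrieveSingle S (honestLog S reqs) x)).support) : y.1 = some (files x) := by
  obtain ⟨z, hz, rfl⟩ := exec_retrieveSingle S hv hx l _ hy
  have hget := database_getElem? hv blank files hx
  have hlen := length_database blank files reqs
  obtain ⟨i₁, i₂⟩ := ACA.mapping_mem_Icc (mapping_eq_some_indexOf hx)
  simp only [SinglePIR.minerAnswer, val_bind]
  generalize (database blank files (state reqs)).val = db at hget hlen
  obtain ⟨hlt, hget⟩ := List.getElem?_eq_some_iff.1 hget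
  have hdec := hP l db (indexOf reqs x - 1) hlt z (by
    rwa [hlen, Nat.sub_add_cancel i₁])
  rw [hdec, hget, Option.filter_some, if_pos (by simpa using hfile)]

/-- Building the database takes `2 ^ m - 1` steps and answering at most `c l * 2 ^ m`, with `2 ^ m ≤
2 n`. -/
theorem minerAnswer_cost_le {P : SinglePIR File} {reqs : List (Request D)} {n : ℕ}
    (hm : 2 ^ (state reqs).m ≤ 2 * n) (blank : File) (files : D → File) (l : ℕ) {c : ℕ → ℕ}
    (hc : P.LinearAnswer c) (q : List Bool) :
    (P.minerAnswer l blank files (state reqs) q).cost ≤ 2 * (c l + 1) * n := by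
  have h1 := hc l q (database blank files (state reqs)).val
  have h2 := database_cost blank files reqs
  have h3 := length_database blank files reqs
  have h4 := Nat.one_le_two_pow (n := (state reqs).m)
  rw [h3, Nat.sub_add_cancel h4] at h1
  rw [SinglePIR.minerAnswer, cost_bind]
  have h5 : c l * 2 ^ (state reqs).m ≤ c l * (2 * n) := Nat.mul_le_mul_left _ hm
  have h6 : 2 * (c l + 1) * n = c l * (2 * n) + 2 * n := by ring
  omega

/-- Each of the fewer than `2 n` entries costs one copy and `s + 1` steps of the matrix product. -/
theorem multiMinerAnswer_cost_le {F : Type} [Field F] {s : ℕ} {reqs : List (Request D)} {n : ℕ}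
    (hm : 2 ^ (state reqs).m ≤ 2 * n) (files : D → Fin s → F) (q : List F) :
    (multiMinerAnswer files (state reqs) q).cost ≤ 4 * (s + 1) * n := by
  have h1 := multiAnswer_cost_le q (database (fun _ => 0) files (state reqs)).val
  have h2 := database_cost (fun _ => 0) files reqs
  rw [length_database] at h1
  rw [multiMinerAnswer, cost_bind, h2]
  have h3 : 2 ^ (state reqs).m - 1 ≤ 2 * n := by omega
  have h4 := Nat.mul_le_mul_left (s + 1) h3
  have h5 : 4 * (s + 1) * n = (s + 1) * (2 * n) + 2 * n + s * (2 * n) := by ring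
  omega

end

theorem efficiency : Efficiency := by
  refine ⟨⟨120 / Real.log 2, ?_⟩, ⟨2, ?_⟩, ⟨4, ?_⟩⟩
  · intro D File _ S reqs L n hv hpeak hn hL r q
    rw [replay_honestLog S hv, Option.some.injEq] at hL
    subst hL
    exact verify_cost_le_log S (two_pow_le hv hpeak (by omega)) hn _ r q
  · intro D File _ S P reqs blank files n l hP hv hfiles hpeak hn
    refine ⟨fun x hx => ⟨fun miner y hy => ?_, fun y hy =>
      exec_retrieveSingle_correct S hP hv blank files hx (hfiles x hx) l hy⟩,
      fun c hc q => minerAnswer_cost_le (two_pow_le hv hpeak hn) blank files l hc q⟩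
    obtain ⟨z, -, rfl⟩ := exec_retrieveSingle S hv hx l miner hy
    rfl
  · intro D F _ _ _ _ f s S pts reqs files n hv hpeak hn
    refine ⟨fun miners x hx y hy => ?_,
      fun q => multiMinerAnswer_cost_le (two_pow_le hv hpeak hn) files q⟩
    have hl := lookupIndex_eq_indexOf S hv hx
    simp only [retrieveMulti, hl, multiExec, PMF.pure_map, PMF.mem_support_bind_iff,
      PMF.support_pure, Set.mem_singleton_iff] at hy
    obtain ⟨q, -, rfl⟩ := hy
    rfl

end PIRDSN

theorem theorem1 :
    PIRDSN.PublicVerifiability ∧ (PIRDSN.SinglePrivacy ∧ PIRDSN.MultiPrivacy) ∧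
      PIRDSN.Robustness ∧ PIRDSN.Efficiency := by
  exact ⟨PIRDSN.publicVerifiability, ⟨PIRDSN.singlePrivacy, PIRDSN.multiPrivacy⟩,
    PIRDSN.robustness, PIRDSN.efficiency⟩
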